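/- Let $q\ge 2$ be an integer and let $\mathcal T$ be a complete, deterministic, subsequential transducer with finitely many states and input alphabet $\{0,\dots,q-1\}$: it has one initial state, for every state and every input digit exactly one transition, an output label on every transition and a final output label at every state. For $n\ge 0$ let $\mathcal T(n)$ be the sum of the transition outputs along the path that starts in the initial state and reads the standard $q$-ary expansion of $n$ from the least significant to the most significant digit, without leading zeros (the empty word for $n=0$), plus the final output of the last state of this path. Let $\mathbb E_N=\frac1N\sum_{0\le n<N}\mathcal T(n)$ be the expected value of $\mathcal T(n)$ for $n$ uniformly distributed on $\{0,\dots,N-1\}$. Assume that all output labels and all final output labels of $\mathcal T$ are integers and that $\mathcal T$ has a reset sequence, i.e., there are an input word and a state $r$ such that reading this word from any state leads to $r$. For $t\in\mathbb R$ let $M(t)$ be the matrix, indexed by the states, whose $(s,s')$ entry is the sum of $e^{it\delta}$ over all transitions from $s$ to $s'$, where $\delta$ is the output of the transition. Let $\mu(t)$ be the eigenvalue of $M(t)$ of largest modulus, for $t$ in a neighbourhood of $0$ (so $\mu(0)=q$), and let $e_{\mathcal T}=-i\,q^{-1}\mu'(0)\in\mathbb R$. Assume that $e_{\mathcal T}\notin\mathbb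 Z$. Then there is exactly one continuous $1$-periodic function $\Psi_1\colon\mathbb R\to\mathbb R$ such that, for some $\xi>0$, $$\mathbb E_N=e_{\mathcal T}\log_q N+\Psi_1(\log_q N)+\mathcal O(N^{-\xi}\log N)\qquad(N\to\infty),$$ and this function $\Psi_1$ is not differentiable at any $x\in\mathbb R$. -/

import Mathlib

open Filter Topology Asymptotics

/-- A dominant eigenvalue of a square complex matrix: an eigenvalue of maximal modulus. -/
def IsDominantEigenvalue {S : Type*} [Fintype S] [DecidableEq S]
    (A : Matrix S S ℂ) (z : ℂ) : Prop :=
  Module.End.HasEigenvalue (Matrix.toLin' A) z ∧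
    ∀ w : ℂ, Module.End.HasEigenvalue (Matrix.toLin' A) w → ‖w‖ ≤ ‖z‖

theorem exists_isDominantEigenvalue {S : Type*} [Fintype S] [DecidableEq S] [Nonempty S]
    (A : Matrix S S ℂ) : ∃ z : ℂ, IsDominantEigenvalue A z := by
  have hfin : (spectrum ℂ (Matrix.toLin' A)).Finite :=
    Module.End.finite_spectrum (Matrix.toLin' A)
  obtain ⟨c, hc⟩ := Module.End.exists_eigenvalue (Matrix.toLin' A)
  obtain ⟨z, hz, hmax⟩ := hfin.exists_maximalFor (fun w => ‖w‖) _
    ⟨c, Module.End.hasEigenvalue_iff_mem_spectrum.1 hc⟩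
  refine ⟨z, Module.End.hasEigenvalue_iff_mem_spectrum.2 hz, fun w hw => ?_⟩
  rcases le_total ‖w‖ ‖z‖ with h | h
  · exact h
  · exact hmax (Module.End.hasEigenvalue_iff_mem_spectrum.1 hw) h

/-- A complete, deterministic, subsequential transducer with input alphabet `{0, …, q - 1}`
and real outputs: exactly one transition for each state and each input digit, an output label
for every transition, a final output label for every state, and one initial state. -/
structure Transducer (q : ℕ) (S : Type*) where
  initial : S
  next : S → Fin q → S
  output : S → Fin q → ℝ
  finalOutput : S → ℝ

namespace Transducer

variable {q : ℕ} {S : Type*}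

/-- The state reached from the state `s` by an input word. Words are lists of digits in the order
in which they are read. -/
def stateAfter (T : Transducer q S) (s : S) (w : List (Fin q)) : S :=
  w.foldl T.next s

/-- The sum of all outputs, final output included, when an input word is read from state `s`. -/
def outputSum (T : Transducer q S) : S → List (Fin q) → ℝ
  | s, [] => T.finalOutput s
  | s, d :: w => T.output s d + T.outputSum (T.next s d) w

/-- The standard `q`-ary digits of `n`, least significant digit first, without leading zeros
(the empty word for `n = 0`). -/
def inputWord (q : ℕ) [NeZero q] (n : ℕ) : List (Fin q) :=
  (Nat.digits q n).map (Fin.ofNat q)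

/-- `𝒯(n)`: the output sum for the `q`-ary expansion of `n`, read from the least significant
digit to the most significant digit, starting in the initial state. -/
def value [NeZero q] (T : Transducer q S) (n : ℕ) : ℝ :=
  T.outputSum T.initial (inputWord q n)

/-- The expected value of `𝒯(n)` for `n` uniformly distributed on `{0, …, N - 1}`. -/
noncomputable def expectedValue [NeZero q] (T : Transducer q S) (N : ℕ) : ℝ :=
  (∑ n ∈ Finset.range N, T.value n) / N

/-- The output alphabet is `ℤ` (for transitions and for final outputs). -/
def HasIntegerOutput (T : Transducer q S) : Prop :=
  (∀ s d, ∃ k : ℤ, T.output s d = k) ∧ ∀ s, ∃ k : ℤ, T.finalOutput s = k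

/-- Some input word leads from every state to one and the same state. -/
def HasResetSequence (T : Transducer q S) : Prop :=
  ∃ (w : List (Fin q)) (r : S), ∀ s, T.stateAfter s w = r

/-- The transition matrix for the input digit `d` at the parameter `t`. -/
noncomputable def digitMatrix [DecidableEq S] (T : Transducer q S) (d : Fin q) (t : ℝ) :
    Matrix S S ℂ :=
  Matrix.of fun s s' =>
    if T.next s d = s' then Complex.exp (Complex.I * t * T.output s d) else 0

/-- The sum `M(t)` of the transition matrices of all digits. -/
noncomputable def transitionMatrix [DecidableEq S] (T : Transducer q S) (t : ℝ) :
    Matrix S S ℂ :=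
  ∑ d : Fin q, T.digitMatrix d t

/-- The dominant eigenvalue `μ(t)` of `M(t)`. For a transducer with a reset sequence it is unique
for all `t` near `0`, and `μ(0) = q`; where there are several, one of them is chosen. -/
noncomputable def dominantEigenvalue [Fintype S] [DecidableEq S] (T : Transducer q S) (t : ℝ) : ℂ :=
  haveI : Nonempty S := ⟨T.initial⟩
  Classical.choose (exists_isDominantEigenvalue (T.transitionMatrix t))

/-- The constant `e_𝒯 = -i q⁻¹ μ'(0)` of the main term of the expected value, for a transducer
whose underlying digraph has exactly one final strongly connected component, this component being
aperiodic (in particular, for a transducer with a reset sequence). It is a real number. -/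
noncomputable def mainConstant [Fintype S] [DecidableEq S] (T : Transducer q S) : ℝ :=
  (-Complex.I * (q : ℂ)⁻¹ * deriv T.dominantEigenvalue 0).re

/-- `Ψ` is the periodic fluctuation in the expected value of `𝒯(n)`: it is continuous and
`1`-periodic, and
`𝔼(𝒯(n)) = e_𝒯 log_q N + Ψ(log_q N) + O(N^{-ξ} log N)` for some `ξ > 0`. -/
structure IsFluctuation [NeZero q] [Fintype S] [DecidableEq S] (T : Transducer q S)
    (Ψ : ℝ → ℝ) : Prop where
  continuous : Continuous Ψ
  periodic : Function.Periodic Ψ 1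
  expansion : ∃ ξ : ℝ, 0 < ξ ∧
    (fun N : ℕ => T.expectedValue N -
        (T.mainConstant * Real.logb q N + Ψ (Real.logb q N)))
      =O[atTop] fun N : ℕ => (N : ℝ) ^ (-ξ) * Real.log N

end Transducer

/-!
The transfer operator `f ↦ (s ↦ ∑ d, f (next s d))` contracts the spread of a function of the states
because of the reset word. Hence the summatory functions of the outputs read from different states
agree up to a linear term `h(s) N` and `O(N^η)` with `η < 1`, where `h` solves a Poisson equation.
It follows that the summatory function `A` of `𝒯(n)` satisfies `A(N) = q A(⌊N/q⌋) + e N + O(N^η)`,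
and Delange's method yields the periodic fluctuation. The constant `e` is identified with `e_𝒯` by
first-order perturbation: `1 + i t h(s)` is an approximate eigenvector of `M(t)` for small `t`.

For the non-differentiability, consider the main term `f(y) = y (e log_q y + Ψ(log_q y))`. If the
low digits of `p` are the reset word, then `f(p + 1) - f(p)` is a constant plus the output for the
remaining digits of `p`, an integer. If `Ψ` were differentiable at `x`, the difference quotients of
`f` at `q^x` with steps `q^(-m)` would converge, so that `k_m - e m` would converge for integers
`k_m`. Then `k_{m+1} - k_m` tends to `e`, and `e` is an integer.
-/

section Growth

theorem isBigO_one_natCast_rpow {η : ℝ} (hη : 0 ≤ η) :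
    (fun _ : ℕ => (1 : ℝ)) =O[atTop] fun N => (N : ℝ) ^ η :=
  IsBigO.of_bound' ((eventually_ge_atTop 1).mono fun N hN => by
    rw [norm_one, Real.norm_of_nonneg (by positivity)]
    exact Real.one_le_rpow (by exact_mod_cast hN) hη)

theorem isBigO_mul_natCast_mod (c : ℝ) {q : ℕ} (hq : q ≠ 0) {η : ℝ} (hη : 0 ≤ η) :
    (fun N : ℕ => c * (N % q : ℕ)) =O[atTop] fun N => (N : ℝ) ^ η := by
  refine (IsBigO.const_mul_left (IsBigO.of_bound q (Eventually.of_forall fun N => ?_)) _).trans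
    (isBigO_one_natCast_rpow hη)
  rw [Real.norm_natCast, norm_one, mul_one]
  exact_mod_cast (Nat.mod_lt N (Nat.pos_of_ne_zero hq)).le

theorem isBigO_add_mul_floor_sub {ι : Type*} {l : Filter ι} {u : ι → ℝ} (hu : ∀ i, 0 ≤ u i)
    (c a : ℝ) : (fun i => c + a * ⌊u i⌋₊ - a * u i) =O[l] fun _ => (1 : ℝ) := by
  refine IsBigO.of_bound (‖c‖ + ‖a‖) (Eventually.of_forall fun i => ?_)
  have hfract : ‖u i - ⌊u i⌋₊‖ ≤ 1 := by
    rw [Real.norm_of_nonneg (sub_nonneg.2 (Nat.floor_le (hu i)))]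
    linarith [Nat.lt_floor_add_one (u i)]
  have hsub : c + a * ⌊u i⌋₊ - a * u i = c - a * (u i - ⌊u i⌋₊) := by ring
  rw [hsub, norm_one, mul_one]
  refine norm_sub_le_of_le le_rfl ?_
  rw [norm_mul]
  exact mul_le_of_le_one_right (norm_nonneg a) hfract

theorem exists_sub_one_lt_rpow {Q : ℝ} (hQ : 0 < Q) : ∃ η : ℝ, 0 < η ∧ η < 1 ∧ Q - 1 < Q ^ η := by
  have hlim : Tendsto (fun η : ℝ => Q ^ η) (𝓝[<] 1) (𝓝 Q) := by
    simpa only [Real.rpow_one] using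
      (Real.continuousAt_const_rpow (b := 1) hQ.ne').tendsto.mono_left nhdsWithin_le_nhds
  have hIoo : ∀ᶠ η : ℝ in 𝓝[<] 1, η ∈ Set.Ioo 0 1 := Ioo_mem_nhdsLT zero_lt_one
  obtain ⟨η, hη, hlt⟩ := (hIoo.and (hlim.eventually (lt_mem_nhds (sub_one_lt Q)))).exists
  exact ⟨η, hη.1, hη.2, hlt⟩

theorem natCast_div_rpow_le (Q : ℕ) {η : ℝ} (hη : 0 ≤ η) (N : ℕ) :
    ((N / Q : ℕ) : ℝ) ^ η ≤ (N : ℝ) ^ η / (Q : ℝ) ^ η := by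
  rw [← Real.div_rpow N.cast_nonneg Q.cast_nonneg]
  exact Real.rpow_le_rpow (Nat.cast_nonneg _) Nat.cast_div_le hη

theorem le_mul_rpow_of_le_mul_div_add {a : ℕ → ℝ} {Q : ℕ} {b C η : ℝ} (hQ : 2 ≤ Q) (hb : 0 ≤ b)
    (hη : 0 ≤ η) (hC : 0 ≤ C) (hbη : b < (Q : ℝ) ^ η) (ha : 0 ≤ a 0)
    (hrec : ∀ N, 1 ≤ N → a N ≤ b * a (N / Q) + C * (N : ℝ) ^ η) {N : ℕ} (hN : 1 ≤ N) :
    a N ≤ (b * a 0 + C) / (1 - b / (Q : ℝ) ^ η) * (N : ℝ) ^ η := by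
  have hQη : 0 < (Q : ℝ) ^ η := hb.trans_lt hbη
  have hθ : 0 < 1 - b / (Q : ℝ) ^ η := sub_pos.2 ((div_lt_one hQη).2 hbη)
  obtain ⟨K, hK⟩ : ∃ K, (b * a 0 + C) / (1 - b / (Q : ℝ) ^ η) = K := ⟨_, rfl⟩
  have hfix : b / (Q : ℝ) ^ η * K + b * a 0 + C = K := by
    linarith [(div_eq_iff hθ.ne').1 hK]
  have hK0 : 0 ≤ K := hK ▸ div_nonneg (by positivity) hθ.le
  rw [hK]
  induction N using Nat.strong_induction_on with
  | _ N ih =>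
    have hNη : 1 ≤ (N : ℝ) ^ η := Real.one_le_rpow (by exact_mod_cast hN) hη
    have hdiv : b * a (N / Q) ≤ (b / (Q : ℝ) ^ η * K + b * a 0) * (N : ℝ) ^ η := by
      rcases Nat.eq_zero_or_pos (N / Q) with h0 | hpos
      · rw [h0]
        refine (le_mul_of_one_le_right (mul_nonneg hb ha) hNη).trans ?_
        gcongr
        exact le_add_of_nonneg_left (by positivity)
      · calc b * a (N / Q) ≤ b * (K * ((N : ℝ) ^ η / (Q : ℝ) ^ η)) := by
              gcongr
              exact (ih _ (Nat.div_lt_self hN hQ) hpos).trans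
                (mul_le_mul_of_nonneg_left (natCast_div_rpow_le Q hη N) hK0)
          _ = b / (Q : ℝ) ^ η * K * (N : ℝ) ^ η := by ring
          _ ≤ _ := by gcongr; exact le_add_of_nonneg_right (by positivity)
    calc a N ≤ (b / (Q : ℝ) ^ η * K + b * a 0) * (N : ℝ) ^ η + C * (N : ℝ) ^ η :=
          (hrec N hN).trans (add_le_add_left hdiv _)
      _ = K * (N : ℝ) ^ η := by rw [← add_mul, hfix]

-- The subcritical case of the master theorem for divide-and-conquer recurrences.
theorem isBigO_rpow_of_le_mul_div_add {a d : ℕ → ℝ} {Q : ℕ} {b η : ℝ} (hQ : 2 ≤ Q) (hb : 0 ≤ b)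
    (hη : 0 ≤ η) (hbη : b < (Q : ℝ) ^ η) (ha : ∀ N, 0 ≤ a N)
    (hrec : ∀ N, a N ≤ b * a (N / Q) + d N) (hd : d =O[atTop] fun N => (N : ℝ) ^ η) :
    a =O[atTop] fun N => (N : ℝ) ^ η := by
  obtain ⟨C, hC, hdC⟩ := bound_of_isBigO_nat_atTop hd
  refine IsBigO.of_bound ((b * a 0 + C) / (1 - b / (Q : ℝ) ^ η))
    ((eventually_ge_atTop 1).mono fun N hN => ?_)
  rw [Real.norm_of_nonneg (ha N), Real.norm_of_nonneg (by positivity)]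
  refine le_mul_rpow_of_le_mul_div_add hQ hb hη hC.le hbη (ha 0) (fun M hM => ?_) hN
  have hMη : 0 < (M : ℝ) ^ η := by positivity
  refine (hrec M).trans (add_le_add_right ((Real.le_norm_self _).trans ?_) _)
  simpa only [Real.norm_of_nonneg hMη.le] using hdC hMη.ne'

theorem isBigO_rpow_comp_div {E : Type*} [NormedAddCommGroup E] {f : ℕ → E} {Q : ℕ} (hQ : Q ≠ 0)
    {η : ℝ} (hη : 0 ≤ η) (hf : f =O[atTop] fun N => (N : ℝ) ^ η) :
    (fun N => f (N / Q)) =O[atTop] fun N => (N : ℝ) ^ η := by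
  refine (hf.comp_tendsto (Nat.tendsto_div_const_atTop hQ)).trans (IsBigO.of_norm_le fun N => ?_)
  rw [Function.comp_apply, Real.norm_of_nonneg (by positivity)]
  exact Real.rpow_le_rpow (by positivity) (by exact_mod_cast Nat.div_le_self N Q) hη

theorem isBigO_sum_range_sub_sum_range_mul_div {E : Type*} [NormedAddCommGroup E] {a : ℕ → E}
    {q : ℕ} (hq : q ≠ 0) {η : ℝ} (hη : 0 ≤ η) (ha : a =O[atTop] fun n => (n : ℝ) ^ η) :
    (fun N => ∑ n ∈ Finset.range N, a n - ∑ n ∈ Finset.range (q * (N / q)), a n)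
      =O[atTop] fun N => (N : ℝ) ^ η := by
  obtain ⟨C, hC, haC⟩ := bound_of_isBigO_nat_atTop ha
  refine IsBigO.of_bound (q * C) ((eventually_ge_atTop q).mono fun N hN => ?_)
  rw [← Finset.sum_Ico_eq_sub _ (Nat.mul_div_le N q), mul_assoc]
  have hterm : ∀ n ∈ Finset.Ico (q * (N / q)) N, ‖a n‖ ≤ C * ‖(N : ℝ) ^ η‖ := fun n hn => by
    obtain ⟨hqn, hnN⟩ := Finset.mem_Ico.1 hn
    have hn0 : 0 < n := (Nat.mul_pos (Nat.pos_of_ne_zero hq)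
      (Nat.div_pos hN (Nat.pos_of_ne_zero hq))).trans_le hqn
    refine (haC (by positivity)).trans ?_
    rw [Real.norm_of_nonneg (by positivity), Real.norm_of_nonneg (by positivity)]
    gcongr
  have hcard : N - q * (N / q) ≤ q := by
    rw [← Nat.mod_eq_sub_mul_div]
    exact (Nat.mod_lt N (Nat.pos_of_ne_zero hq)).le
  calc ‖∑ n ∈ Finset.Ico (q * (N / q)) N, a n‖ ≤ (N - q * (N / q) : ℕ) * (C * ‖(N : ℝ) ^ η‖) := by
        simpa only [Finset.sum_const, Nat.card_Ico, nsmul_eq_mul] using norm_sum_le_of_le _ hterm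
    _ ≤ q * (C * ‖(N : ℝ) ^ η‖) := by gcongr

end Growth

section AsymptoticallyPeriodic

variable {E : Type*} [NormedAddCommGroup E] {G Ψ : ℝ → E}

-- `Ψ` is the locally uniform limit of the translates of `G` by the natural numbers.
theorem continuous_of_periodic_of_tendsto_sub (hΨ : Function.Periodic Ψ 1)
    (hG : Continuous G) (h : Tendsto (fun x => G x - Ψ x) atTop (𝓝 0)) : Continuous Ψ := by
  have hunif : TendstoLocallyUniformly (fun (j : ℕ) x => G (x + j)) Ψ atTop := by
    refine Metric.tendstoLocallyUniformly_iff.2 fun ε hε x => ?_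
    obtain ⟨X, hX⟩ := eventually_atTop.1 (Metric.tendsto_nhds.1 h ε hε)
    refine ⟨Set.Ioi (x - 1), Ioi_mem_nhds (sub_one_lt x), ?_⟩
    filter_upwards [tendsto_natCast_atTop_atTop.eventually_ge_atTop (X - (x - 1))] with j hj y hy
    have hyX : X ≤ y + j := by linarith [Set.mem_Ioi.1 hy]
    have hper : Ψ (y + j) = Ψ y := by simpa only [mul_one] using hΨ.nat_mul j y
    rw [dist_comm, dist_eq_norm, ← hper, ← dist_zero_right]
    exact hX _ hyX
  exact hunif.continuous (Frequently.of_forall fun j => hG.comp (continuous_add_const _))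

theorem exists_periodic_sub_isBigO [CompleteSpace E] {ρ : ℝ} (hρ : 0 < ρ) (hρ1 : ρ < 1)
    (h : (fun x => G (x + 1) - G x) =O[atTop] fun x => ρ ^ x) :
    ∃ Ψ : ℝ → E, Function.Periodic Ψ 1 ∧ (fun x => G x - Ψ x) =O[atTop] fun x => ρ ^ x := by
  obtain ⟨C, hC⟩ := h.bound
  obtain ⟨X, hX⟩ := eventually_atTop.1 hC
  have hdist : ∀ x, X ≤ x → ∀ j : ℕ,
      dist (G (x + j)) (G (x + (j + 1 : ℕ))) ≤ C * ρ ^ x * ρ ^ j := by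
    intro x hx j
    have hj := hX (x + j) (hx.trans (le_add_of_nonneg_right j.cast_nonneg))
    rw [dist_eq_norm, norm_sub_rev]
    push_cast
    rwa [Real.norm_of_nonneg (by positivity), Real.rpow_add hρ, Real.rpow_natCast, ← mul_assoc,
      add_assoc] at hj
  have hlim : ∀ x, ∃ z, Tendsto (fun j : ℕ => G (x + j)) atTop (𝓝 z) := by
    intro x
    obtain ⟨k, hk⟩ := exists_nat_ge (X - x)
    obtain ⟨z, hz⟩ := cauchySeq_tendsto_of_complete
      (cauchySeq_of_le_geometric _ _ hρ1 (hdist (x + k) (by linarith)))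
    refine ⟨z, (tendsto_add_atTop_iff_nat k).1 (hz.congr fun j => ?_)⟩
    push_cast
    ring_nf
  choose Ψ hΨ using hlim
  refine ⟨Ψ, fun x => ?_, ?_⟩
  · refine tendsto_nhds_unique ((hΨ (x + 1)).congr fun j => ?_)
      ((tendsto_add_atTop_iff_nat 1).2 (hΨ x))
    push_cast
    ring_nf
  · refine IsBigO.of_bound (C / (1 - ρ)) ((eventually_ge_atTop X).mono fun x hx => ?_)
    have := dist_le_of_le_geometric_of_tendsto₀ ρ _ hρ1 (hdist x hx) (hΨ x)
    rw [← dist_eq_norm, Real.norm_of_nonneg (by positivity), div_mul_eq_mul_div]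
    simpa using this

end AsymptoticallyPeriodic

section Uniqueness

theorem eq_zero_of_periodic_of_tendsto_logb {E : Type*} [TopologicalSpace E] [T2Space E] [Zero E]
    {D : ℝ → E} {q : ℝ} (hq : 1 < q) (hD : Continuous D) (hper : Function.Periodic D 1)
    (hlim : Tendsto (fun N : ℕ => D (Real.logb q N)) atTop (𝓝 0)) : D = 0 := by
  have hq0 : 0 < q := zero_lt_one.trans hq
  funext x
  have hpow : Tendsto (fun k : ℕ => q ^ k) atTop atTop := tendsto_pow_atTop_atTop_of_one_lt hq
  have hfloor : Tendsto (fun k : ℕ => ⌊q ^ x * q ^ k⌋₊) atTop atTop :=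
    tendsto_nat_floor_atTop.comp (hpow.const_mul_atTop (by positivity))
  have hlog : Tendsto (fun k : ℕ => Real.logb q ⌊q ^ x * q ^ k⌋₊ - k) atTop (𝓝 x) := by
    have hratio : Tendsto (fun k : ℕ => (⌊q ^ x * q ^ k⌋₊ : ℝ) / q ^ k) atTop (𝓝 (q ^ x)) :=
      (tendsto_nat_floor_mul_div_atTop (by positivity)).comp hpow
    have hlog := (Real.continuousAt_logb (b := q) (by positivity)).tendsto.comp hratio
    rw [Real.logb_rpow hq0 hq.ne'] at hlog
    refine hlog.congr' ((hfloor.eventually_gt_atTop 0).mono fun k hk => ?_)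
    rw [Function.comp_apply, Real.logb_div (by positivity) (by positivity), Real.logb_pow,
      Real.logb_self_eq_one hq, mul_one]
  refine tendsto_nhds_unique ?_ (hlim.comp hfloor)
  refine ((hD.tendsto x).comp hlog).congr fun k => ?_
  simpa using hper.sub_nat_mul_eq k

end Uniqueness

section Interpolation

/-- The piecewise linear function with values `∑ n ∈ Finset.range N, a n` at the natural numbers
`N`: every index `n` contributes `a n` with the weight `max 0 (min 1 (y - n))`, which vanishes for
`y ≤ n`, so that the sum may be cut off at `⌈y⌉₊`. -/
noncomputable def interpolatedSum (a : ℕ → ℝ) (y : ℝ) : ℝ :=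
  ∑ n ∈ Finset.range ⌈y⌉₊, max 0 (min 1 (y - n)) * a n

variable (a : ℕ → ℝ)

theorem interpolatedSum_eq_sum_range {y : ℝ} {M : ℕ} (hM : y ≤ M) :
    interpolatedSum a y = ∑ n ∈ Finset.range M, max 0 (min 1 (y - n)) * a n := by
  refine Finset.sum_subset (Finset.range_mono (Nat.ceil_le.2 hM)) fun n _ hn => ?_
  have hyn : y ≤ n := Nat.ceil_le.1 (not_lt.1 (mt Finset.mem_range.2 hn))
  rw [max_eq_left ((min_le_right _ _).trans (sub_nonpos.2 hyn)), zero_mul]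

theorem continuous_interpolatedSum : Continuous (interpolatedSum a) := by
  refine continuous_iff_continuousAt.2 fun y => ?_
  obtain ⟨M, hM⟩ := exists_nat_gt y
  have hsum : Continuous fun y : ℝ => ∑ n ∈ Finset.range M, max 0 (min 1 (y - n)) * a n := by
    fun_prop
  exact hsum.continuousAt.congr
    ((eventually_lt_nhds hM).mono fun z hz => (interpolatedSum_eq_sum_range a hz.le).symm)

theorem interpolatedSum_eq_add {y : ℝ} (hy : 0 ≤ y) :
    interpolatedSum a y = ∑ n ∈ Finset.range ⌊y⌋₊, a n + (y - ⌊y⌋₊) * a ⌊y⌋₊ := by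
  have hfloor := Nat.floor_le hy
  have hlt := Nat.lt_floor_add_one y
  rw [interpolatedSum_eq_sum_range a (M := ⌊y⌋₊ + 1) (by push_cast; exact hlt.le),
    Finset.sum_range_succ, min_eq_right (by linarith), max_eq_right (sub_nonneg.2 hfloor)]
  congr 1
  refine Finset.sum_congr rfl fun n hn => ?_
  have hn1 : (n : ℝ) + 1 ≤ ⌊y⌋₊ := by exact_mod_cast Finset.mem_range.1 hn
  rw [min_eq_left (by linarith), max_eq_right zero_le_one, one_mul]

theorem interpolatedSum_natCast (N : ℕ) :
    interpolatedSum a N = ∑ n ∈ Finset.range N, a n := by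
  simp [interpolatedSum_eq_add]

theorem isBigO_interpolatedSum_sub {η : ℝ} (hη : 0 ≤ η) {a : ℕ → ℝ}
    (ha : a =O[atTop] fun n => (n : ℝ) ^ η) :
    (fun y => interpolatedSum a y - ∑ n ∈ Finset.range ⌊y⌋₊, a n) =O[atTop] fun y => y ^ η := by
  have hfrac : (fun y => interpolatedSum a y - ∑ n ∈ Finset.range ⌊y⌋₊, a n)
      =O[atTop] fun y => a ⌊y⌋₊ := by
    refine IsBigO.of_bound 1 ((eventually_ge_atTop 0).mono fun y hy => ?_)
    rw [interpolatedSum_eq_add a hy, add_sub_cancel_left, norm_mul]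
    gcongr
    rw [Real.norm_of_nonneg (sub_nonneg.2 (Nat.floor_le hy))]
    linarith [Nat.lt_floor_add_one y]
  refine (hfrac.trans (ha.comp_tendsto tendsto_nat_floor_atTop)).trans
    (IsBigO.of_bound 1 ((eventually_ge_atTop 0).mono fun y hy => ?_))
  rw [one_mul, Function.comp_apply, Real.norm_of_nonneg (by positivity),
    Real.norm_of_nonneg (by positivity)]
  exact Real.rpow_le_rpow (by positivity) (Nat.floor_le hy) hη

end Interpolation

section Delange

theorem exists_periodic_of_mul_sub_isBigO {B : ℝ → ℝ} {q e η : ℝ} (hq : 1 < q) (hη : η < 1)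
    (hB : Continuous B)
    (hstep : (fun y => B (q * y) - q * B y - e * (q * y)) =O[atTop] fun y => y ^ η) :
    ∃ Ψ : ℝ → ℝ, Continuous Ψ ∧ Function.Periodic Ψ 1 ∧
      (fun y => B y / y - (e * Real.logb q y + Ψ (Real.logb q y)))
        =O[atTop] fun y => y ^ (η - 1) := by
  have hq0 : 0 < q := zero_lt_one.trans hq
  have hρ1 : q ^ (η - 1) < 1 := Real.rpow_lt_one_of_one_lt_of_neg hq (sub_neg.2 hη)
  have hcomm : ∀ x : ℝ, (q ^ (η - 1)) ^ x = (q ^ x) ^ (η - 1) := fun x => by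
    rw [← Real.rpow_mul hq0.le, mul_comm, Real.rpow_mul hq0.le]
  obtain ⟨G, hG⟩ : ∃ G : ℝ → ℝ, ∀ x, G x = B (q ^ x) / q ^ x - e * x := ⟨_, fun _ => rfl⟩
  have hGcont : Continuous G := by
    rw [funext hG]
    have hpow : Continuous fun x : ℝ => q ^ x := Real.continuous_const_rpow hq0.ne'
    exact ((hB.comp hpow).div hpow fun x => by positivity).sub (continuous_const_mul e)
  have hGstep : (fun x => G (x + 1) - G x) =O[atTop] fun x => (q ^ (η - 1)) ^ x := by
    have hdiv : (fun y => (B (q * y) - q * B y - e * (q * y)) * y⁻¹)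
        =O[atTop] fun y => y ^ (η - 1) :=
      (hstep.mul (isBigO_refl _ _)).congr' .rfl ((eventually_gt_atTop 0).mono fun y hy => by
        simp only [Real.rpow_sub_one hy.ne', div_eq_mul_inv])
    refine ((hdiv.comp_tendsto (tendsto_rpow_atTop_of_base_gt_one q hq)).const_mul_left q⁻¹).congr
      (fun x => ?_) fun x => (hcomm x).symm
    rw [Function.comp_apply, hG, hG, Real.rpow_add_one hq0.ne']
    field_simp
    ring
  obtain ⟨Ψ, hΨ, hGΨ⟩ := exists_periodic_sub_isBigO (by positivity) hρ1 hGstep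
  have hlim : Tendsto (fun x => G x - Ψ x) atTop (𝓝 0) :=
    hGΨ.trans_tendsto (tendsto_rpow_atTop_of_base_lt_one _
      (neg_one_lt_zero.trans (by positivity)) hρ1)
  refine ⟨Ψ, continuous_of_periodic_of_tendsto_sub hΨ hGcont hlim, hΨ,
    (hGΨ.comp_tendsto (Real.tendsto_logb_atTop hq)).congr' ?_ ?_⟩
  · filter_upwards [eventually_gt_atTop 0] with y hy
    rw [Function.comp_apply, hG, Real.rpow_logb hq0 hq.ne' hy]
    ring
  · filter_upwards [eventually_gt_atTop 0] with y hy
    rw [Function.comp_apply, hcomm, Real.rpow_logb hq0 hq.ne' hy]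

theorem isBigO_interpolatedSum_mul_sub {a : ℕ → ℝ} {q : ℕ} {e η : ℝ} (hq : q ≠ 0) (hη : 0 ≤ η)
    (ha : a =O[atTop] fun n => (n : ℝ) ^ η)
    (hrec : (fun N : ℕ => ∑ n ∈ Finset.range N, a n - q * ∑ n ∈ Finset.range (N / q), a n - e * N)
      =O[atTop] fun N => (N : ℝ) ^ η) :
    (fun y : ℝ => interpolatedSum a (q * y) - q * interpolatedSum a y - e * (q * y))
      =O[atTop] fun y => y ^ η := by
  have hq0 : (0 : ℝ) < q := by positivity
  have hmul : Tendsto (fun y : ℝ => q * y) atTop atTop := tendsto_id.const_mul_atTop hq0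
  have hpow : (fun y : ℝ => (q * y) ^ η) =O[atTop] fun y => y ^ η :=
    ((isBigO_refl (fun y : ℝ => y ^ η) atTop).const_mul_left ((q : ℝ) ^ η)).congr'
      ((eventually_ge_atTop 0).mono fun y hy => (Real.mul_rpow hq0.le hy).symm) .rfl
  have hfloor : (fun y : ℝ => (⌊y⌋₊ : ℝ) ^ η) =O[atTop] fun y => y ^ η :=
    IsBigO.of_bound' ((eventually_ge_atTop 0).mono fun y hy => by
      rw [Real.norm_of_nonneg (by positivity), Real.norm_of_nonneg (by positivity)]
      exact Real.rpow_le_rpow (by positivity) (Nat.floor_le hy) hη)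
  have hfract : (fun y : ℝ => (⌊y⌋₊ : ℝ) - y) =O[atTop] fun y => y ^ η :=
    IsBigO.of_bound' ((eventually_ge_atTop 1).mono fun y hy => by
      have hy0 : 0 ≤ y := zero_le_one.trans hy
      rw [norm_sub_rev, Real.norm_of_nonneg (sub_nonneg.2 (Nat.floor_le hy0)),
        Real.norm_of_nonneg (by positivity)]
      linarith [Nat.lt_floor_add_one y, Real.one_le_rpow hy hη])
  have hinterp := isBigO_interpolatedSum_sub hη ha
  have hrec' := (hrec.comp_tendsto tendsto_nat_floor_atTop).trans hfloor
  have hscaled := (((hinterp.add hrec').add (hfract.const_mul_left e)).comp_tendsto hmul).trans hpow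
  refine (hscaled.sub (hinterp.const_mul_left q)).congr_left fun y => ?_
  have hdiv : ⌊q * y⌋₊ / q = ⌊y⌋₊ := by
    rw [← Nat.floor_div_natCast, mul_div_cancel_left₀ _ hq0.ne']
  simp only [Function.comp_apply, hdiv]
  ring

-- Delange's method; interpolation makes the periodic function continuous.
theorem exists_periodic_of_sum_range_sub_mul_div {a : ℕ → ℝ} {q : ℕ} {e η : ℝ} (hq : 2 ≤ q)
    (hη : 0 ≤ η) (hη1 : η < 1) (ha : a =O[atTop] fun n => (n : ℝ) ^ η)
    (hrec : (fun N : ℕ => ∑ n ∈ Finset.range N, a n - q * ∑ n ∈ Finset.range (N / q), a n - e * N)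
      =O[atTop] fun N => (N : ℝ) ^ η) :
    ∃ Ψ : ℝ → ℝ, Continuous Ψ ∧ Function.Periodic Ψ 1 ∧
      (fun N : ℕ => (∑ n ∈ Finset.range N, a n) / N - (e * Real.logb q N + Ψ (Real.logb q N)))
        =O[atTop] fun N => (N : ℝ) ^ (η - 1) := by
  obtain ⟨Ψ, hcont, hper, hΨ⟩ := exists_periodic_of_mul_sub_isBigO (by exact_mod_cast hq) hη1
    (continuous_interpolatedSum a) (isBigO_interpolatedSum_mul_sub (by omega) hη ha hrec)
  refine ⟨Ψ, hcont, hper, ?_⟩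
  simpa only [Function.comp_def, interpolatedSum_natCast] using
    hΨ.comp_tendsto tendsto_natCast_atTop_atTop

end Delange

section DifferenceQuotients

theorem isLittleO_sub_sub_smul_of_hasDerivAt {ι E : Type*} [NormedAddCommGroup E]
    [NormedSpace ℝ E] {l : Filter ι} {f : ℝ → E} {f' : E} {y : ℝ} {a b ε : ι → ℝ}
    (hf : HasDerivAt f f' y) (hε : Tendsto ε l (𝓝 0)) (ha : (fun i => a i - y) =O[l] ε)
    (hb : (fun i => b i - y) =O[l] ε) :
    (fun i => f (b i) - f (a i) - (b i - a i) • f') =o[l] ε := by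
  have hnear : ∀ {c : ι → ℝ}, (fun i => c i - y) =O[l] ε →
      (fun i => f (c i) - f y - (c i - y) • f') =o[l] ε := fun {c} hc => by
    have hcy : Tendsto c l (𝓝 y) := by
      simpa only [sub_add_cancel, zero_add] using (hc.trans_tendsto hε).add_const y
    exact ((hasDerivAt_iff_isLittleO.1 hf).comp_tendsto hcy).trans_isBigO hc
  refine ((hnear hb).sub (hnear ha)).congr_left fun i => ?_
  module

theorem exists_int_eq_of_tendsto_sub_mul {k : ℕ → ℤ} {e L : ℝ}
    (h : Tendsto (fun m => (k m : ℝ) - e * m) atTop (𝓝 L)) : ∃ n : ℤ, (n : ℝ) = e := by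
  have hdiff : Tendsto (fun m => ((k (m + 1) - k m : ℤ) : ℝ)) atTop (𝓝 e) := by
    have h' := (((tendsto_add_atTop_iff_nat 1).2 h).sub h).add_const e
    rw [sub_self, zero_add] at h'
    refine h'.congr fun m => ?_
    push_cast
    ring
  exact Int.isClosedEmbedding_coe_real.isClosed_range.mem_of_tendsto hdiff
    (Eventually.of_forall fun m => ⟨_, rfl⟩)

end DifferenceQuotients

section Eigenvalues

open scoped Matrix

variable {S : Type*} [Fintype S] [DecidableEq S]

theorem hasEigenvalue_toLin'_iff_det {K : Type*} [Field K] (A : Matrix S S K) (z : K) :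
    Module.End.HasEigenvalue (Matrix.toLin' A) z ↔ (Matrix.scalar S z - A).det = 0 := by
  rw [Module.End.hasEigenvalue_iff_isRoot_charpoly, Matrix.charpoly_toLin', Polynomial.IsRoot,
    Matrix.eval_charpoly]

theorem pow_sub_norm_le_norm_det_scalar_sub {A : Matrix S S ℂ} {z x : ℂ}
    (hz : IsDominantEigenvalue A z) (hx : ‖z‖ ≤ ‖x‖) :
    (‖x‖ - ‖z‖) ^ Fintype.card S ≤ ‖(Matrix.scalar S x - A).det‖ := by
  have hsplits := IsAlgClosed.splits A.charpoly
  have hdet : ‖(Matrix.scalar S x - A).det‖ = (A.charpoly.roots.map fun w => ‖x - w‖).prod := by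
    rw [← Matrix.eval_charpoly, hsplits.eval_eq_prod_roots_of_monic A.charpoly_monic]
    simpa only [Multiset.map_map, Function.comp_def, normHom_apply] using
      map_multiset_prod (normHom : ℂ →*₀ ℝ) (A.charpoly.roots.map (x - ·))
  have hroot : ∀ w ∈ A.charpoly.roots, ‖x‖ - ‖z‖ ≤ ‖x - w‖ := fun w hw => by
    have hwz : ‖w‖ ≤ ‖z‖ := hz.2 w (by
      rw [Module.End.hasEigenvalue_iff_isRoot_charpoly, Matrix.charpoly_toLin']
      exact (Polynomial.mem_roots'.1 hw).2)
    linarith [norm_sub_norm_le x w]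
  rw [hdet, ← Matrix.charpoly_natDegree_eq_dim A, hsplits.natDegree_eq_card_roots,
    ← Multiset.prod_replicate, ← Multiset.map_const']
  exact Multiset.prod_map_le_prod_map₀ _ _ (fun _ _ => sub_nonneg.2 hx) hroot

-- Bordering by a rank one matrix produces a left null vector of a singular matrix that
-- depends continuously on the matrix.
theorem vecMul_inv_vecMul_eq_zero {K : Type*} [Field K] {B : Matrix S S K} {a b : S → K}
    (hB : B.det = 0) (hunit : IsUnit (B + Matrix.vecMulVec a b).det) :
    (b ᵥ* (B + Matrix.vecMulVec a b)⁻¹) ⬝ᵥ a = 1 ∧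
      (b ᵥ* (B + Matrix.vecMulVec a b)⁻¹) ᵥ* B = 0 := by
  obtain ⟨z, hz, hzB⟩ := Matrix.exists_vecMul_eq_zero_iff.2 hB
  have hzC : z ᵥ* (B + Matrix.vecMulVec a b) = (z ⬝ᵥ a) • b := by
    rw [Matrix.vecMul_add, hzB, zero_add, Matrix.vecMul_vecMulVec]
  have hz_eq : z = (z ⬝ᵥ a) • (b ᵥ* (B + Matrix.vecMulVec a b)⁻¹) := by
    rw [← Matrix.smul_vecMul, ← hzC, Matrix.vecMul_vecMul, Matrix.mul_nonsing_inv _ hunit,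
      Matrix.vecMul_one]
  have hza : z ⬝ᵥ a ≠ 0 := fun h0 => hz (by rw [hz_eq, h0, zero_smul])
  constructor
  · refine mul_left_cancel₀ hza ?_
    rw [← smul_eq_mul, ← smul_dotProduct, ← hz_eq, mul_one]
  · refine (smul_eq_zero.1 ?_).resolve_left hza
    rw [← Matrix.smul_vecMul, ← hz_eq, hzB]

theorem exists_tendsto_vecMul_eq_zero {𝕜 ι : Type*} [NormedField 𝕜] {l : Filter ι}
    {B : ι → Matrix S S 𝕜} {B₀ : Matrix S S 𝕜} {a b : S → 𝕜} (hB : Tendsto B l (𝓝 B₀))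
    (hdet : ∀ᶠ i in l, (B i).det = 0) (hunit : IsUnit (B₀ + Matrix.vecMulVec a b).det) :
    ∃ (y : ι → S → 𝕜) (y₀ : S → 𝕜), Tendsto y l (𝓝 y₀) ∧
      ∀ᶠ i in l, y i ⬝ᵥ a = 1 ∧ y i ᵥ* B i = 0 := by
  have hborder : Tendsto (fun i => B i + Matrix.vecMulVec a b) l (𝓝 (B₀ + Matrix.vecMulVec a b)) :=
    hB.add_const _
  have hinv : ContinuousAt Inv.inv (B₀ + Matrix.vecMulVec a b) := by
    refine continuousAt_matrix_inv _ ?_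
    rw [Ring.inverse_eq_inv']
    exact continuousAt_inv₀ hunit.ne_zero
  have hvecMul : Continuous fun C : Matrix S S 𝕜 => b ᵥ* C :=
    continuous_const.matrix_vecMul continuous_id
  refine ⟨_, _, (hvecMul.tendsto _).comp (hinv.tendsto.comp hborder), ?_⟩
  have hdet_ne : ∀ᶠ i in l, (B i + Matrix.vecMulVec a b).det ≠ 0 :=
    ((continuous_id.matrix_det.tendsto _).comp hborder).eventually_ne hunit.ne_zero
  filter_upwards [hdet, hdet_ne] with i hi hne
  exact vecMul_inv_vecMul_eq_zero hi hne.isUnit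

-- Pair the residual with left null vectors `y i` of `μ i - A i`, normalised by `y i ⬝ᵥ a = 1`.
theorem isLittleO_eigenvalue_sub {𝕜 ι F : Type*} [NormedField 𝕜] [SeminormedAddCommGroup F]
    {l : Filter ι} {A : ι → Matrix S S 𝕜} {A₀ : Matrix S S 𝕜} {μ ν : ι → 𝕜} {μ₀ : 𝕜}
    {u : ι → S → 𝕜} {a b : S → 𝕜} {g : ι → F} (hA : Tendsto A l (𝓝 A₀)) (hμ : Tendsto μ l (𝓝 μ₀))
    (hu : Tendsto u l (𝓝 a)) (hdet : ∀ᶠ i in l, (Matrix.scalar S (μ i) - A i).det = 0)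
    (hunit : IsUnit (Matrix.scalar S μ₀ - A₀ + Matrix.vecMulVec a b).det)
    (hres : (fun i => A i *ᵥ u i - ν i • u i) =o[l] g) :
    (fun i => μ i - ν i) =o[l] g := by
  have hscalar : Continuous fun z : 𝕜 => Matrix.scalar S z :=
    (continuous_pi fun _ => continuous_id).matrix_diagonal
  have hB : Tendsto (fun i => Matrix.scalar S (μ i) - A i) l (𝓝 (Matrix.scalar S μ₀ - A₀)) :=
    ((hscalar.tendsto μ₀).comp hμ).sub hA
  obtain ⟨y, y₀, hy, hnull⟩ := exists_tendsto_vecMul_eq_zero hB hdet hunit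
  have hyu : Tendsto (fun i => y i ⬝ᵥ u i) l (𝓝 1) := by
    have hdot : Continuous fun p : (S → 𝕜) × (S → 𝕜) => p.1 ⬝ᵥ p.2 :=
      continuous_fst.dotProduct continuous_snd
    have hy₀a : Tendsto (fun i => y i ⬝ᵥ (u i - a)) l (𝓝 0) := by
      simpa only [Function.comp_def, sub_self, dotProduct_zero] using
        (hdot.tendsto (y₀, a - a)).comp (hy.prodMk_nhds (hu.sub_const a))
    refine (zero_add (1 : 𝕜) ▸ hy₀a.add_const 1).congr' (hnull.mono fun i hi => ?_)
    rw [dotProduct_sub, hi.1, sub_add_cancel]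
  have htest : ∀ᶠ i in l, y i ⬝ᵥ (A i *ᵥ u i - ν i • u i) = (μ i - ν i) * (y i ⬝ᵥ u i) := by
    filter_upwards [hnull] with i hi
    have h0 : y i ⬝ᵥ ((Matrix.scalar S (μ i) - A i) *ᵥ u i) = 0 :=
      (Matrix.dotProduct_mulVec _ _ _).trans (by rw [hi.2, zero_dotProduct])
    rw [Matrix.sub_mulVec, Matrix.scalar_apply, Matrix.diagonal_const_mulVec, dotProduct_sub,
      dotProduct_smul, smul_eq_mul, sub_eq_zero] at h0
    rw [dotProduct_sub, dotProduct_smul, ← h0, smul_eq_mul, sub_mul]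
  have hpair : (fun i => y i ⬝ᵥ (A i *ᵥ u i - ν i • u i)) =o[l] g := by
    refine IsLittleO.fun_sum fun s _ => IsBigO.trans_isLittleO ?_ (isLittleO_pi.1 hres s)
    simpa only [one_mul] using
      ((tendsto_pi_nhds.1 hy s).isBigO_one 𝕜).mul (isBigO_refl (fun i => _) l)
  have hdivide : (fun i => μ i - ν i) =O[l] fun i => (μ i - ν i) * (y i ⬝ᵥ u i) := by
    simpa only [Function.const_apply, mul_one] using (isBigO_refl (fun i => μ i - ν i) l).mul
      ((isEquivalent_const_iff_tendsto one_ne_zero).2 hyu).isBigO_symm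
  exact hdivide.trans_isLittleO (hpair.congr' htest .rfl)

end Eigenvalues

section Spread

variable {S E : Type*} [Fintype S] [SeminormedAddCommGroup E]

/-- The spread `max ‖f s - f s'‖` of a function on a finite type. It measures the dependence
of a function of the states on the state, and is contracted by the transfer operator. -/
noncomputable def spread (f : S → E) : ℝ :=
  ‖fun p : S × S => f p.1 - f p.2‖

theorem spread_nonneg (f : S → E) : 0 ≤ spread f :=
  norm_nonneg _

theorem norm_sub_le_spread (f : S → E) (s s' : S) : ‖f s - f s'‖ ≤ spread f :=
  norm_le_pi_norm (fun p : S × S => f p.1 - f p.2) (s, s')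

theorem spread_le {f : S → E} {C : ℝ} (hC : 0 ≤ C) (h : ∀ s s', ‖f s - f s'‖ ≤ C) :
    spread f ≤ C :=
  (pi_norm_le_iff_of_nonneg hC).2 fun p => h p.1 p.2

theorem spread_add_le (f g : S → E) : spread (f + g) ≤ spread f + spread g := by
  refine spread_le (add_nonneg (spread_nonneg f) (spread_nonneg g)) fun s s' => ?_
  rw [Pi.add_apply, Pi.add_apply, add_sub_add_comm]
  exact norm_add_le_of_le (norm_sub_le_spread f s s') (norm_sub_le_spread g s s')

theorem spread_le_two_mul_norm (f : S → E) : spread f ≤ 2 * ‖f‖ := by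
  refine spread_le (by positivity) fun s s' => ?_
  rw [two_mul]
  exact norm_sub_le_of_le (norm_le_pi_norm f s) (norm_le_pi_norm f s')

theorem spread_smul_add_const {𝕜 : Type*} [NormedField 𝕜] [NormedSpace 𝕜 E] (z : 𝕜) (f : S → E)
    (c : E) : spread (z • f + Function.const S c) = ‖z‖ * spread f := by
  rw [spread, spread, ← norm_smul]
  congr 1
  funext p
  simp [smul_sub]

end Spread

namespace Transducer

section Transfer

variable {q : ℕ} {S : Type*}

/-- The transfer operator, which sums a function over the successors of a state. It carries the
dependence on the initial state through the summatory functions of the outputs, and it is the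
action of `M(0)` on vectors indexed by the states. -/
def transfer (R : Type*) [Semiring R] (T : Transducer q S) : Module.End R (S → R) :=
  ∑ d, LinearMap.funLeft R R fun s => T.next s d

theorem transfer_apply {R : Type*} [Semiring R] (T : Transducer q S) (f : S → R) (s : S) :
    T.transfer R f s = ∑ d, f (T.next s d) := by
  simp [transfer, LinearMap.sum_apply, LinearMap.funLeft_apply]

theorem transfer_const {R : Type*} [Semiring R] (T : Transducer q S) (c : R) :
    T.transfer R (Function.const S c) = Function.const S (q * c) := by
  funext s
  simp [transfer_apply]

theorem transfer_pow_const {R : Type*} [Semiring R] (T : Transducer q S) (k : ℕ) (c : R) :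
    (T.transfer R ^ k) (Function.const S c) = Function.const S (q ^ k * c) := by
  induction k with
  | zero => simp
  | succ k ih => rw [pow_succ', Module.End.mul_apply, ih, transfer_const, pow_succ', mul_assoc]

theorem transfer_pow_apply {R : Type*} [Semiring R] (T : Transducer q S) (k : ℕ) (f : S → R)
    (s : S) :
    (T.transfer R ^ k) f s = ∑ w : Fin k → Fin q, f (T.stateAfter s (List.ofFn w)) := by
  induction k generalizing s with
  | zero => simp [stateAfter]
  | succ k ih =>
    rw [pow_succ', Module.End.mul_apply, transfer_apply, ← (Fin.consEquiv fun _ => Fin q).sum_comp,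
      Fintype.sum_prod_type]
    exact Finset.sum_congr rfl fun d _ => by simp [ih, stateAfter, Fin.consEquiv]

theorem exists_transfer_pow_eq {𝕜 : Type*} [Field 𝕜] {T : Transducer q S} {f : S → 𝕜}
    {z c : 𝕜} (hf : T.transfer 𝕜 f = z • f + Function.const S c) (k : ℕ) :
    ∃ c', (T.transfer 𝕜 ^ k) f = z ^ k • f + Function.const S c' := by
  induction k with
  | zero => exact ⟨0, by simp⟩
  | succ k ih =>
    obtain ⟨c', hc'⟩ := ih
    refine ⟨z ^ k * c + q * c', ?_⟩
    rw [pow_succ', Module.End.mul_apply, hc', map_add, map_smul, hf, transfer_const]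
    funext s
    simp only [Pi.add_apply, Pi.smul_apply, smul_eq_mul, Function.const_apply]
    ring

variable [Fintype S]

theorem spread_transfer_pow_le {R : Type*} [NormedRing R] (T : Transducer q S) (k : ℕ)
    (f : S → R) : spread ((T.transfer R ^ k) f) ≤ q ^ k * spread f := by
  refine spread_le (mul_nonneg (by positivity) (spread_nonneg f)) fun s s' => ?_
  rw [transfer_pow_apply, transfer_pow_apply, ← Finset.sum_sub_distrib]
  simpa using norm_sum_le_of_le Finset.univ fun (w : Fin k → Fin q) _ =>
    norm_sub_le_spread f (T.stateAfter s (List.ofFn w)) (T.stateAfter s' (List.ofFn w))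

-- The summand of the reset word does not depend on the starting state.
theorem spread_transfer_pow_le_of_reset {R : Type*} [NormedRing R] {T : Transducer q S}
    {w : List (Fin q)} {r : S} (hw : ∀ s, T.stateAfter s w = r) (f : S → R) :
    spread ((T.transfer R ^ w.length) f) ≤ (q ^ w.length - 1) * spread f := by
  classical
  have hcard : ((Finset.univ.erase w.get).card : ℝ) = q ^ w.length - 1 := by
    rw [Finset.card_erase_of_mem (Finset.mem_univ _),
      Nat.cast_sub (Finset.card_pos.2 ⟨w.get, Finset.mem_univ _⟩)]
    simp
  refine spread_le (mul_nonneg (hcard ▸ Nat.cast_nonneg _) (spread_nonneg f))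
    fun s s' => ?_
  rw [transfer_pow_apply, transfer_pow_apply, ← Finset.sum_sub_distrib,
    ← Finset.sum_erase _ (a := w.get) (by rw [List.ofFn_get, hw, hw, sub_self]), ← hcard,
    ← nsmul_eq_mul, ← Finset.sum_const]
  exact norm_sum_le_of_le _ fun v _ => norm_sub_le_spread f _ _

theorem HasResetSequence.exists_spread_transfer_pow_le [NeZero q] {T : Transducer q S}
    (hreset : T.HasResetSequence) (R : Type*) [NormedRing R] :
    ∃ l, 1 ≤ l ∧ ∀ f : S → R,
      spread ((T.transfer R ^ l) f) ≤ (q ^ l - 1) * spread f := by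
  obtain ⟨w, r, hw⟩ := hreset
  exact ⟨(0 :: w).length, Nat.succ_pos _,
    spread_transfer_pow_le_of_reset (w := 0 :: w) (r := r) fun s => hw _⟩

end Transfer

section PoissonEquation

variable {q : ℕ} [NeZero q] {S : Type*} [Finite S]

theorem HasResetSequence.eq_of_transfer_eq {𝕜 : Type*} [NormedField 𝕜] {T : Transducer q S}
    (hreset : T.HasResetSequence) {f : S → 𝕜} {z c : 𝕜} (hz : ‖z‖ = q)
    (hf : T.transfer 𝕜 f = z • f + Function.const S c) (s s' : S) : f s = f s' := by
  cases nonempty_fintype S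
  obtain ⟨l, -, hl⟩ := hreset.exists_spread_transfer_pow_le 𝕜
  obtain ⟨c', hc'⟩ := exists_transfer_pow_eq hf l
  have hosc := hl f
  rw [hc', spread_smul_add_const, norm_pow, hz] at hosc
  have hnorm := norm_sub_le_spread f s s'
  exact sub_eq_zero.1 (norm_le_zero_iff.1 (by linarith))

theorem HasResetSequence.eq_zero_of_transfer_eq {𝕜 : Type*} [RCLike 𝕜] {T : Transducer q S}
    (hreset : T.HasResetSequence) {f : S → 𝕜}
    (hf : T.transfer 𝕜 f = (q : 𝕜) • f + Function.const S (f T.initial)) : f = 0 := by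
  have hconst : ∀ s, f s = f T.initial := fun s =>
    hreset.eq_of_transfer_eq (RCLike.norm_natCast q) hf s T.initial
  have hinit := congrFun hf T.initial
  simp only [transfer_apply, hconst, Finset.sum_const, Finset.card_univ, Fintype.card_fin,
    nsmul_eq_mul, Pi.add_apply, Pi.smul_apply, smul_eq_mul, Function.const_apply,
    left_eq_add] at hinit
  funext s
  rw [hconst, hinit, Pi.zero_apply]

/-- The Poisson equation of the Markov chain of uniformly random digits, whose solution is a
potential `h` on the states together with the mean output `e` per digit. It is multiplied by `q`
here: both the mean of the outputs and the mean of `h` over the successors of `s` appear as sums. -/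
def IsPoissonSolution (T : Transducer q S) (e : ℝ) (h : S → ℝ) : Prop :=
  ∀ s, ∑ d, T.output s d = q * (e + h s) - T.transfer ℝ h s

theorem HasResetSequence.exists_isPoissonSolution {T : Transducer q S}
    (hreset : T.HasResetSequence) : ∃ e h, T.IsPoissonSolution e h := by
  let L : Module.End ℝ (S → ℝ) := (q : ℝ) • LinearMap.id
    + LinearMap.pi (fun _ => LinearMap.proj T.initial) - T.transfer ℝ
  have hL : ∀ h s, L h s = q * h s + h T.initial - T.transfer ℝ h s := fun h s => by simp [L]
  have hinj : Function.Injective L := (injective_iff_map_eq_zero L).2 fun h h0 =>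
    hreset.eq_zero_of_transfer_eq (funext fun s => (sub_eq_zero.1 ((hL h s).symm.trans
      (congrFun h0 s))).symm)
  obtain ⟨h, hh⟩ := LinearMap.injective_iff_surjective.1 hinj fun s => ∑ d, T.output s d
  refine ⟨h T.initial / q, h, fun s => ?_⟩
  have hq : (q : ℝ) ≠ 0 := NeZero.ne _
  rw [← congrFun hh s, hL]
  field_simp
  ring

end PoissonEquation

section DominantEigenvalue

open scoped Matrix

variable {q : ℕ} {S : Type*} [DecidableEq S]

theorem continuous_transitionMatrix (T : Transducer q S) : Continuous T.transitionMatrix := by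
  refine continuous_finsetSum _ fun d _ => continuous_matrix fun s s' => ?_
  simp only [digitMatrix, Matrix.of_apply]
  split_ifs <;> fun_prop

variable [Fintype S]

theorem transitionMatrix_mulVec (T : Transducer q S) (t : ℝ) (v : S → ℂ) (s : S) :
    (T.transitionMatrix t *ᵥ v) s =
      ∑ d, Complex.exp (Complex.I * t * T.output s d) * v (T.next s d) := by
  simp only [transitionMatrix, Matrix.sum_mulVec, Finset.sum_apply]
  exact Finset.sum_congr rfl fun d _ => by simp [digitMatrix, Matrix.mulVec, dotProduct]

theorem transitionMatrix_zero_mulVec (T : Transducer q S) (v : S → ℂ) :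
    T.transitionMatrix 0 *ᵥ v = T.transfer ℂ v := by
  funext s
  simp [transitionMatrix_mulVec, transfer_apply]

theorem norm_transitionMatrix_mulVec_le (T : Transducer q S) (t : ℝ) (v : S → ℂ) :
    ‖T.transitionMatrix t *ᵥ v‖ ≤ q * ‖v‖ := by
  refine (pi_norm_le_iff_of_nonneg (by positivity)).2 fun s => ?_
  rw [transitionMatrix_mulVec]
  simpa using norm_sum_le_of_le Finset.univ fun d _ => show
    ‖Complex.exp (Complex.I * t * T.output s d) * v (T.next s d)‖ ≤ ‖v‖ by
      rw [norm_mul, mul_assoc, ← Complex.ofReal_mul, Complex.norm_exp_I_mul_ofReal, one_mul]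
      exact norm_le_pi_norm v _

theorem norm_le_of_hasEigenvalue {T : Transducer q S} {t : ℝ} {z : ℂ}
    (hz : Module.End.HasEigenvalue (Matrix.toLin' (T.transitionMatrix t)) z) : ‖z‖ ≤ q := by
  obtain ⟨v, hv⟩ := hz.exists_hasEigenvector
  have hvz : T.transitionMatrix t *ᵥ v = z • v := by simpa using hv.apply_eq_smul
  refine le_of_mul_le_mul_right ?_ (norm_pos_iff.2 hv.2)
  rw [← norm_smul, ← hvz]
  exact T.norm_transitionMatrix_mulVec_le t v

theorem hasEigenvalue_transitionMatrix_zero (T : Transducer q S) :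
    Module.End.HasEigenvalue (Matrix.toLin' (T.transitionMatrix 0)) (q : ℂ) := by
  refine Module.End.hasEigenvalue_of_hasEigenvector (x := Function.const S 1) ⟨?_, ?_⟩
  · rw [Module.End.mem_eigenspace_iff, Matrix.toLin'_apply, transitionMatrix_zero_mulVec,
      transfer_const]
    rfl
  · exact fun h => one_ne_zero (congrFun h T.initial)

theorem HasResetSequence.eq_of_hasEigenvalue [NeZero q] {T : Transducer q S}
    (hreset : T.HasResetSequence) {z : ℂ}
    (hz : Module.End.HasEigenvalue (Matrix.toLin' (T.transitionMatrix 0)) z) (hnorm : ‖z‖ = q) :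
    z = q := by
  obtain ⟨v, hv⟩ := hz.exists_hasEigenvector
  have hvz : T.transfer ℂ v = z • v := by
    simpa [transitionMatrix_zero_mulVec] using hv.apply_eq_smul
  have hconst : v = Function.const S (v T.initial) := funext fun s =>
    hreset.eq_of_transfer_eq (c := 0) hnorm (by simpa using hvz) s T.initial
  rw [hconst, transfer_const] at hvz
  have hinit : v T.initial ≠ 0 := fun h => hv.2 (by rw [hconst, h]; rfl)
  exact (mul_right_cancel₀ hinit (congrFun hvz T.initial)).symm

theorem isDominantEigenvalue_dominantEigenvalue (T : Transducer q S) (t : ℝ) :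
    IsDominantEigenvalue (T.transitionMatrix t) (T.dominantEigenvalue t) :=
  haveI : Nonempty S := ⟨T.initial⟩
  Classical.choose_spec (exists_isDominantEigenvalue (T.transitionMatrix t))

theorem det_scalar_dominantEigenvalue_sub (T : Transducer q S) (t : ℝ) :
    (Matrix.scalar S (T.dominantEigenvalue t) - T.transitionMatrix t).det = 0 :=
  (hasEigenvalue_toLin'_iff_det _ _).1 (T.isDominantEigenvalue_dominantEigenvalue t).1

theorem norm_dominantEigenvalue_le (T : Transducer q S) (t : ℝ) : ‖T.dominantEigenvalue t‖ ≤ q :=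
  norm_le_of_hasEigenvalue (T.isDominantEigenvalue_dominantEigenvalue t).1

theorem tendsto_norm_dominantEigenvalue (T : Transducer q S) :
    Tendsto (fun t => ‖T.dominantEigenvalue t‖) (𝓝 0) (𝓝 (q : ℝ)) := by
  have : Nonempty S := ⟨T.initial⟩
  have hle : ∀ t, ‖T.dominantEigenvalue t‖ ≤ ‖(q : ℂ)‖ := fun t => by
    simpa using T.norm_dominantEigenvalue_le t
  have hdet : Tendsto (fun t => ‖(Matrix.scalar S (q : ℂ) - T.transitionMatrix t).det‖)
      (𝓝 0) (𝓝 0) := by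
    have hcont : Continuous fun t => ‖(Matrix.scalar S (q : ℂ) - T.transitionMatrix t).det‖ :=
      (continuous_const.sub T.continuous_transitionMatrix).matrix_det.norm
    have hzero := (hasEigenvalue_toLin'_iff_det _ _).1 T.hasEigenvalue_transitionMatrix_zero
    simpa only [hzero, norm_zero] using hcont.tendsto 0
  have hpow := squeeze_zero (fun t => pow_nonneg (sub_nonneg.2 (hle t)) _) (fun t =>
    pow_sub_norm_le_norm_det_scalar_sub (T.isDominantEigenvalue_dominantEigenvalue t) (hle t)) hdet
  have hdiff : Tendsto (fun t => ‖(q : ℂ)‖ - ‖T.dominantEigenvalue t‖) (𝓝 0) (𝓝 0) :=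
    (isLittleO_one_iff ℝ).1 (IsLittleO.of_pow (g := fun _ => (1 : ℝ))
      (by simpa [Pi.pow_def] using (isLittleO_one_iff ℝ).2 hpow) Fintype.card_ne_zero)
  simpa using hdiff.const_sub ‖(q : ℂ)‖

theorem IsPoissonSolution.hasDerivAt_transitionMatrix_mulVec_sub {T : Transducer q S}
    {e : ℝ} {h : S → ℝ} (hh : T.IsPoissonSolution e h) :
    HasDerivAt (fun t : ℝ => (T.transitionMatrix t *ᵥ fun s => 1 + Complex.I * t * h s)
      - ((q : ℂ) * (1 + Complex.I * t * e)) • fun s => 1 + Complex.I * t * h s) 0 0 := by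
  have hlin (c : ℂ) : HasDerivAt (fun t : ℝ => Complex.I * t * c) (Complex.I * c) 0 := by
    simpa using (Complex.ofRealCLM.hasDerivAt.const_mul Complex.I).mul_const c
  refine hasDerivAt_pi.2 fun s => ?_
  have hpoisson : (∑ d, (Complex.I * T.output s d + Complex.I * h (T.next s d)))
      - ((q : ℂ) * (Complex.I * e) + q * (Complex.I * h s)) = 0 := by
    have hs := congrArg (fun x : ℝ => (x : ℂ)) (hh s)
    simp only [transfer_apply] at hs
    push_cast at hs
    rw [Finset.sum_add_distrib, ← Finset.mul_sum, ← Finset.mul_sum, hs]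
    ring
  have hrow (d : Fin q) : HasDerivAt (fun t : ℝ => Complex.exp (Complex.I * t * T.output s d)
      * (1 + Complex.I * t * h (T.next s d)))
      (Complex.I * T.output s d + Complex.I * h (T.next s d)) 0 := by
    simpa using (hlin (T.output s d)).cexp.fun_mul ((hlin (h (T.next s d))).const_add 1)
  have heig : HasDerivAt (fun t : ℝ => (q : ℂ) * (1 + Complex.I * t * e)
      * (1 + Complex.I * t * h s)) (q * (Complex.I * e) + q * (Complex.I * h s)) 0 := by
    simpa using ((hlin e).const_add 1 |>.const_mul (q : ℂ)).fun_mul ((hlin (h s)).const_add 1)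
  have hsub := (HasDerivAt.fun_sum (u := Finset.univ) fun d _ => hrow d).fun_sub heig
  rw [hpoisson] at hsub
  simpa [transitionMatrix_mulVec] using hsub

variable [NeZero q] {T : Transducer q S}

theorem HasResetSequence.dominantEigenvalue_zero (hreset : T.HasResetSequence) :
    T.dominantEigenvalue 0 = q := by
  have hdom := T.isDominantEigenvalue_dominantEigenvalue 0
  refine hreset.eq_of_hasEigenvalue hdom.1 (le_antisymm (T.norm_dominantEigenvalue_le 0) ?_)
  simpa using hdom.2 _ T.hasEigenvalue_transitionMatrix_zero

theorem HasResetSequence.tendsto_dominantEigenvalue (hreset : T.HasResetSequence) :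
    Tendsto T.dominantEigenvalue (𝓝 0) (𝓝 (q : ℂ)) := by
  refine (isCompact_closedBall (0 : ℂ) q).tendsto_nhds_of_unique_mapClusterPt
    (Eventually.of_forall fun t => by simpa using T.norm_dominantEigenvalue_le t) fun z _ hz => ?_
  obtain ⟨U, hU, hUz⟩ := mapClusterPt_iff_ultrafilter.1 hz
  refine hreset.eq_of_hasEigenvalue ?_
    (tendsto_nhds_unique hUz.norm (T.tendsto_norm_dominantEigenvalue.mono_left hU))
  have hdet : Continuous fun p : ℂ × Matrix S S ℂ => (Matrix.scalar S p.1 - p.2).det :=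
    (((continuous_pi fun _ => continuous_fst).matrix_diagonal).sub continuous_snd).matrix_det
  have hlim := (hdet.tendsto (z, T.transitionMatrix 0)).comp (hUz.prodMk_nhds
    ((T.continuous_transitionMatrix.tendsto 0).mono_left hU))
  refine (hasEigenvalue_toLin'_iff_det _ _).2 (tendsto_nhds_unique hlim ?_)
  exact tendsto_const_nhds.congr fun t => (T.det_scalar_dominantEigenvalue_sub t).symm

theorem HasResetSequence.isUnit_det_scalar_sub_add_vecMulVec (hreset : T.HasResetSequence) :
    IsUnit (Matrix.scalar S (q : ℂ) - T.transitionMatrix 0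
      + Matrix.vecMulVec (Function.const S 1) (Pi.single T.initial 1)).det := by
  refine isUnit_iff_ne_zero.2 fun hdet => ?_
  obtain ⟨v, hv, hv0⟩ := Matrix.exists_mulVec_eq_zero_iff.2 hdet
  rw [Matrix.add_mulVec, Matrix.sub_mulVec, Matrix.scalar_apply, Matrix.diagonal_const_mulVec,
    transitionMatrix_zero_mulVec, Matrix.vecMulVec_mulVec, single_one_dotProduct] at hv0
  refine hv (hreset.eq_zero_of_transfer_eq ?_)
  rw [sub_add_eq_add_sub, sub_eq_zero] at hv0
  rw [← hv0]
  congr 1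
  funext s
  simp

-- First-order perturbation theory: `1 + i t h` is an eigenvector of `M(t)` for the eigenvalue
-- `q (1 + i t e)` up to an error `o(t)`.
theorem HasResetSequence.hasDerivAt_dominantEigenvalue (hreset : T.HasResetSequence) {e : ℝ}
    {h : S → ℝ} (hh : T.IsPoissonSolution e h) :
    HasDerivAt T.dominantEigenvalue (Complex.I * q * e) 0 := by
  have hu : Tendsto (fun (t : ℝ) s => 1 + Complex.I * t * (h s : ℂ)) (𝓝 0)
      (𝓝 (Function.const S 1)) := by
    have hcont : Continuous fun (t : ℝ) s => 1 + Complex.I * t * (h s : ℂ) := by fun_prop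
    simpa [Function.const_def] using hcont.tendsto 0
  have hresidual : (fun t : ℝ => (T.transitionMatrix t *ᵥ fun s => 1 + Complex.I * t * h s)
      - ((q : ℂ) * (1 + Complex.I * t * e)) • fun s => 1 + Complex.I * t * h s)
      =o[𝓝 0] fun t : ℝ => t := by
    have hzero : (T.transitionMatrix 0 *ᵥ fun _ => 1) = (q : ℂ) • fun _ => 1 := by
      rw [transitionMatrix_zero_mulVec]
      exact T.transfer_const 1
    simpa [hzero] using hasDerivAt_iff_isLittleO.1 hh.hasDerivAt_transitionMatrix_mulVec_sub
  have hperturb := isLittleO_eigenvalue_sub (T.continuous_transitionMatrix.tendsto 0)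
    hreset.tendsto_dominantEigenvalue hu
    (Eventually.of_forall T.det_scalar_dominantEigenvalue_sub)
    hreset.isUnit_det_scalar_sub_add_vecMulVec hresidual
  refine hasDerivAt_iff_isLittleO.2 (hperturb.congr (fun t => ?_) fun t => (sub_zero t).symm)
  rw [hreset.dominantEigenvalue_zero, sub_zero, Complex.real_smul]
  ring

theorem HasResetSequence.mainConstant_eq (hreset : T.HasResetSequence) {e : ℝ} {h : S → ℝ}
    (hh : T.IsPoissonSolution e h) : T.mainConstant = e := by
  have hcancel : -Complex.I * (q : ℂ)⁻¹ * (Complex.I * q * e) = e := by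
    have hq : (q : ℂ) ≠ 0 := NeZero.ne _
    field_simp
    rw [Complex.I_sq]
    ring
  rw [mainConstant, (hreset.hasDerivAt_dominantEigenvalue hh).deriv, hcancel, Complex.ofReal_re]

theorem HasResetSequence.exists_isPoissonSolution_mainConstant (hreset : T.HasResetSequence) :
    ∃ h, T.IsPoissonSolution T.mainConstant h := by
  obtain ⟨e, h, hh⟩ := hreset.exists_isPoissonSolution
  exact ⟨h, (hreset.mainConstant_eq hh).symm ▸ hh⟩

end DominantEigenvalue

section SummatoryFunctions

variable {q : ℕ} {S : Type*}

theorem HasIntegerOutput.exists_int_eq_outputSum {T : Transducer q S} (hint : T.HasIntegerOutput)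
    (s : S) (w : List (Fin q)) : ∃ k : ℤ, T.outputSum s w = k := by
  induction w generalizing s with
  | nil => exact hint.2 s
  | cons d w ih =>
    obtain ⟨k, hk⟩ := ih (T.next s d)
    obtain ⟨l, hl⟩ := hint.1 s d
    exact ⟨l + k, by rw [outputSum, hk, hl, Int.cast_add]⟩

variable [NeZero q]

/-- The output sum for the `q`-ary expansion of `n` as a function of the state in which the reading
starts. -/
def valueFrom (T : Transducer q S) (n : ℕ) (s : S) : ℝ :=
  T.outputSum s (inputWord q n)

/-- The summatory function of `valueFrom`, again as a function of the starting state. -/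
def valueSum (T : Transducer q S) (N : ℕ) : S → ℝ :=
  ∑ n ∈ Finset.range N, T.valueFrom n

theorem valueSum_apply (T : Transducer q S) (N : ℕ) (s : S) :
    T.valueSum N s = ∑ n ∈ Finset.range N, T.valueFrom n s :=
  Finset.sum_apply _ _ _

theorem expectedValue_eq (T : Transducer q S) (N : ℕ) :
    T.expectedValue N = T.valueSum N T.initial / N := by
  rw [valueSum_apply]
  rfl

theorem valueFrom_add_mul (T : Transducer q S) (hq : 2 ≤ q) (d : Fin q) {n : ℕ} (hn : n ≠ 0)
    (s : S) : T.valueFrom (d + q * n) s = T.output s d + T.valueFrom n (T.next s d) := by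
  have hword : inputWord q (d + q * n) = d :: inputWord q n := by
    rw [inputWord, Nat.digits_add q hq d n d.isLt (Or.inr hn), List.map_cons]
    congr 1
    ext
    simp
  rw [valueFrom, hword]
  rfl

theorem sum_range_valueFrom_mul_add (T : Transducer q S) (hq : 2 ≤ q) {M : ℕ} (hM : M ≠ 0) :
    ∑ r ∈ Finset.range q, T.valueFrom (q * M + r) =
      (fun s => ∑ d, T.output s d) + T.transfer ℝ (T.valueFrom M) := by
  funext s
  rw [Finset.sum_range, Finset.sum_apply, Pi.add_apply, transfer_apply, ← Finset.sum_add_distrib]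
  exact Finset.sum_congr rfl fun d _ => by rw [add_comm, T.valueFrom_add_mul hq d hM]

theorem valueSum_mul_succ (T : Transducer q S) (hq : 2 ≤ q) {M : ℕ} (hM : M ≠ 0) :
    T.valueSum (q * (M + 1)) = T.valueSum (q * M) + ((fun s => ∑ d, T.output s d)
      + T.transfer ℝ (T.valueFrom M)) := by
  rw [valueSum, mul_add_one, Finset.sum_range_add, T.sum_range_valueFrom_mul_add hq hM]
  rfl

theorem valueSum_mul_sub (T : Transducer q S) (hq : 2 ≤ q) {M : ℕ} (hM : 1 ≤ M) :
    T.valueSum (q * M) - T.transfer ℝ (T.valueSum M) - (M : ℝ) • (fun s => ∑ d, T.output s d) =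
      T.valueSum q - T.transfer ℝ (T.valueSum 1) - fun s => ∑ d, T.output s d := by
  induction M, hM using Nat.le_induction with
  | base => simp
  | succ M hM ih =>
    have hsucc : T.valueSum (M + 1) = T.valueSum M + T.valueFrom M := Finset.sum_range_succ _ _
    rw [← ih, T.valueSum_mul_succ hq (Nat.one_le_iff_ne_zero.1 hM), hsucc, map_add, Nat.cast_succ,
      add_smul, one_smul]
    abel

-- The letters read below digit `j` produce the same output for `p` and `p'`, which cancels.
theorem valueSum_block_sub (T : Transducer q S) (hq : 2 ≤ q) {p p' : ℕ} (hp : p ≠ 0) (hp' : p' ≠ 0)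
    (j : ℕ) :
    T.valueSum (q ^ j * (p + 1)) - T.valueSum (q ^ j * p)
        - (T.valueSum (q ^ j * (p' + 1)) - T.valueSum (q ^ j * p')) =
      (T.transfer ℝ ^ j) (T.valueFrom p - T.valueFrom p') := by
  induction j with
  | zero => simp [valueSum, Finset.sum_range_succ]
  | succ j ih =>
    have hstep : ∀ {p : ℕ}, p ≠ 0 →
        T.valueSum (q ^ (j + 1) * (p + 1)) - T.valueSum (q ^ (j + 1) * p) =
          T.transfer ℝ (T.valueSum (q ^ j * (p + 1)) - T.valueSum (q ^ j * p))
            + (q ^ j : ℝ) • (fun s => ∑ d, T.output s d) := fun {p} hp => by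
      have hlow := T.valueSum_mul_sub hq (M := q ^ j * p) (Nat.one_le_iff_ne_zero.2 (by positivity))
      have hhigh := T.valueSum_mul_sub hq (M := q ^ j * (p + 1))
        (Nat.one_le_iff_ne_zero.2 (by positivity))
      rw [← hlow, ← mul_assoc, ← mul_assoc, ← pow_succ'] at hhigh
      push_cast at hhigh
      rw [map_sub]
      linear_combination (norm := (push_cast; module)) hhigh
    rw [hstep hp, hstep hp', add_sub_add_right_eq_sub, ← map_sub, ih, pow_succ',
      Module.End.mul_apply]

theorem valueFrom_ofDigits_add_sub (T : Transducer q S) (hq : 2 ≤ q) (w : List (Fin q)) {n n' : ℕ}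
    (hn : n ≠ 0) (hn' : n' ≠ 0) (s : S) :
    T.valueFrom (Nat.ofDigits q (w.map Fin.val) + q ^ w.length * n) s
        - T.valueFrom (Nat.ofDigits q (w.map Fin.val) + q ^ w.length * n') s =
      T.valueFrom n (T.stateAfter s w) - T.valueFrom n' (T.stateAfter s w) := by
  induction w generalizing s with
  | nil => simp [stateAfter]
  | cons d w ih =>
    have hcons : ∀ {n : ℕ}, n ≠ 0 →
        T.valueFrom (Nat.ofDigits q ((d :: w).map Fin.val) + q ^ (d :: w).length * n) s =
          T.output s d
            + T.valueFrom (Nat.ofDigits q (w.map Fin.val) + q ^ w.length * n) (T.next s d) :=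
      fun {n} hn => by
        rw [← T.valueFrom_add_mul hq d (by positivity), List.map_cons, Nat.ofDigits_cons,
          List.length_cons, pow_succ', mul_assoc, mul_add, add_assoc]
    rw [hcons hn, hcons hn', add_sub_add_left_eq_sub, ih]
    rfl

end SummatoryFunctions

section Asymptotics

variable {q : ℕ} {S : Type*}

theorem norm_outputSum_le [Fintype S] (T : Transducer q S) (s : S) (w : List (Fin q)) :
    ‖T.outputSum s w‖ ≤ ‖T.finalOutput‖ + w.length * ‖T.output‖ := by
  induction w generalizing s with
  | nil => simpa [outputSum] using norm_le_pi_norm T.finalOutput s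
  | cons d w ih =>
    have hd : ‖T.output s d‖ ≤ ‖T.output‖ :=
      (norm_le_pi_norm (T.output s) d).trans (norm_le_pi_norm T.output s)
    refine (norm_add_le_of_le hd (ih (T.next s d))).trans_eq ?_
    rw [List.length_cons]
    push_cast
    ring

variable [NeZero q]

theorem isBigO_length_inputWord (hq : 2 ≤ q) {η : ℝ} (hη : 0 < η) :
    (fun n => ((inputWord q n).length : ℝ)) =O[atTop] fun n => (n : ℝ) ^ η := by
  have hle : ∀ n : ℕ, ((inputWord q n).length : ℝ) ≤ (Real.log q)⁻¹ * Real.log n + 1 := fun n => by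
    have hlen : (inputWord q n).length ≤ Nat.log q n + 1 := by
      rw [inputWord, List.length_map]
      exact Nat.digits_length_le_iff hq n |>.2 (Nat.lt_pow_succ_log_self hq n)
    have hlog : (Nat.log q n : ℝ) ≤ (Real.log q)⁻¹ * Real.log n :=
      (Real.natLog_le_logb n q).trans_eq (div_eq_inv_mul _ _)
    calc ((inputWord q n).length : ℝ) ≤ Nat.log q n + 1 := by exact_mod_cast hlen
      _ ≤ _ := by gcongr
  have hlog : (fun n : ℕ => Real.log n) =O[atTop] fun n => (n : ℝ) ^ η :=
    (isLittleO_log_rpow_atTop hη).isBigO.comp_tendsto tendsto_natCast_atTop_atTop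
  refine (IsBigO.of_norm_le fun n => ?_).trans
    ((hlog.const_mul_left (Real.log q)⁻¹).add (isBigO_one_natCast_rpow hη.le))
  rw [Real.norm_of_nonneg (Nat.cast_nonneg _)]
  exact hle n

theorem isBigO_valueFrom [Finite S] (T : Transducer q S) (hq : 2 ≤ q) {η : ℝ} (hη : 0 < η) (s : S) :
    (fun n => T.valueFrom n s) =O[atTop] fun n => (n : ℝ) ^ η := by
  cases nonempty_fintype S
  refine (IsBigO.of_norm_le fun n => T.norm_outputSum_le s (inputWord q n)).trans ?_
  exact ((isBigO_const_const _ one_ne_zero _).trans (isBigO_one_natCast_rpow hη.le)).add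
    ((isBigO_length_inputWord hq hη).mul (isBigO_refl _ _) |>.trans
      (by simpa [mul_comm] using isBigO_const_mul_self ‖T.output‖ _ _))

theorem isBigO_valueSum_sub_transfer [Finite S] (T : Transducer q S) (hq : 2 ≤ q) {η : ℝ}
    (hη : 0 < η) (s : S) :
    (fun N => T.valueSum N s - T.transfer ℝ (T.valueSum (N / q)) s
      - (N / q : ℕ) * ∑ d, T.output s d) =O[atTop] fun N => (N : ℝ) ^ η := by
  have htail := isBigO_sum_range_sub_sum_range_mul_div (NeZero.ne q) hη.le
    (T.isBigO_valueFrom hq hη s)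
  have hblock : (fun N => T.valueSum (q * (N / q)) s - T.transfer ℝ (T.valueSum (N / q)) s
      - (N / q : ℕ) * ∑ d, T.output s d) =O[atTop] fun N => (N : ℝ) ^ η := by
    refine IsBigO.trans (EventuallyEq.isBigO ((eventually_ge_atTop q).mono fun N hN =>
      congrFun (T.valueSum_mul_sub hq (Nat.div_pos hN (by omega))) s)) ?_
    exact (isBigO_const_const _ one_ne_zero _).trans (isBigO_one_natCast_rpow hη.le)
  refine (htail.add hblock).congr_left fun N => ?_
  rw [valueSum_apply, valueSum_apply]
  ring

variable {T : Transducer q S} {e : ℝ} {h : S → ℝ}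

-- Subtracting `N h(s)` removes the dependence on `s` of the linear term of the recursion.
theorem IsPoissonSolution.isBigO_valueSum_sub_smul_sub_transfer [Fintype S]
    (hh : T.IsPoissonSolution e h) (hq : 2 ≤ q) {η : ℝ} (hη : 0 < η) :
    (fun N : ℕ => (T.valueSum N - (N : ℝ) • h)
        - T.transfer ℝ (T.valueSum (N / q) - ((N / q : ℕ) : ℝ) • h) - Function.const S (e * N))
      =O[atTop] fun N => (N : ℝ) ^ η := by
  refine isBigO_pi.2 fun s => ?_
  have hmod := isBigO_mul_natCast_mod (e + h s) (NeZero.ne q) hη.le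
  refine ((T.isBigO_valueSum_sub_transfer hq hη s).sub hmod).congr_left fun N => ?_
  have hN : (N : ℝ) = q * (N / q : ℕ) + (N % q : ℕ) := by
    exact_mod_cast (Nat.div_add_mod N q).symm
  simp only [hh s, map_sub, map_smul, Pi.sub_apply, Pi.smul_apply, smul_eq_mul,
    Function.const_apply]
  rw [hN]
  ring

theorem isBigO_spread_sub_transfer_pow [Fintype S] {U : ℕ → S → ℝ} {c : ℕ → ℝ} {η : ℝ} (hη : 0 ≤ η)
    (hU : (fun N => U N - T.transfer ℝ (U (N / q)) - Function.const S (c N))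
      =O[atTop] fun N => (N : ℝ) ^ η) (k : ℕ) :
    (fun N => spread (U N - (T.transfer ℝ ^ k) (U (N / q ^ k))))
      =O[atTop] fun N => (N : ℝ) ^ η := by
  induction k with
  | zero => simp [spread, isBigO_zero]
  | succ k ih =>
    have hinner := (isBigO_rpow_comp_div (NeZero.ne q) hη ih).const_mul_left (q : ℝ)
    refine IsBigO.trans (IsBigO.of_norm_le fun N => ?_) ((hU.norm_left.const_mul_left 2).add hinner)
    set D := U N - T.transfer ℝ (U (N / q)) - Function.const S (c N)
    set V := U (N / q) - (T.transfer ℝ ^ k) (U (N / q / q ^ k))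
    have hsplit : U N - (T.transfer ℝ ^ (k + 1)) (U (N / q ^ (k + 1))) =
        (1 : ℝ) • (D + T.transfer ℝ V) + Function.const S (c N) := by
      simp only [D, V, map_sub]
      rw [pow_succ' (T.transfer ℝ), Module.End.mul_apply, Nat.div_div_eq_div_mul, pow_succ' q]
      module
    rw [Real.norm_of_nonneg (spread_nonneg _), hsplit, spread_smul_add_const, norm_one, one_mul]
    refine (spread_add_le _ _).trans (add_le_add (spread_le_two_mul_norm D) ?_)
    simpa using T.spread_transfer_pow_le 1 V

theorem HasResetSequence.exists_isBigO_spread [Fintype S] (hreset : T.HasResetSequence) (hq : 2 ≤ q)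
    {U : ℕ → S → ℝ} {c : ℕ → ℝ}
    (hU : ∀ η : ℝ, 0 < η → (fun N => U N - T.transfer ℝ (U (N / q)) - Function.const S (c N))
      =O[atTop] fun N => (N : ℝ) ^ η) :
    ∃ η : ℝ, 0 < η ∧ η < 1 ∧ (fun N => spread (U N)) =O[atTop] fun N => (N : ℝ) ^ η := by
  obtain ⟨l, hl, hcontract⟩ := hreset.exists_spread_transfer_pow_le ℝ
  have hql : 2 ≤ q ^ l := hq.trans (Nat.le_self_pow (by omega) q)
  obtain ⟨η, hη, hη1, hlt⟩ := exists_sub_one_lt_rpow (Q := ((q ^ l : ℕ) : ℝ)) (by positivity)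
  refine ⟨η, hη, hη1, isBigO_rpow_of_le_mul_div_add hql ?_ hη.le hlt (fun N => spread_nonneg _)
    (fun N => ?_) (isBigO_spread_sub_transfer_pow hη.le (hU η hη) l)⟩
  · exact sub_nonneg.2 (by exact_mod_cast (by omega : 1 ≤ q ^ l))
  · calc spread (U N)
        = spread ((T.transfer ℝ ^ l) (U (N / q ^ l))
            + (U N - (T.transfer ℝ ^ l) (U (N / q ^ l)))) := by rw [add_sub_cancel]
      _ ≤ _ := spread_add_le _ _
      _ ≤ _ := by
        push_cast
        gcongr
        exact hcontract _

theorem HasResetSequence.exists_isBigO_valueSum_sub_mul [Finite S] (hreset : T.HasResetSequence)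
    (hq : 2 ≤ q) (hh : T.IsPoissonSolution e h) (s : S) :
    ∃ η : ℝ, 0 < η ∧ η < 1 ∧ (fun N : ℕ => T.valueSum N s - q * T.valueSum (N / q) s - e * N)
      =O[atTop] fun N => (N : ℝ) ^ η := by
  cases nonempty_fintype S
  obtain ⟨η, hη, hη1, hspread⟩ := hreset.exists_isBigO_spread hq fun η hη =>
    hh.isBigO_valueSum_sub_smul_sub_transfer hq hη
  refine ⟨η, hη, hη1, ?_⟩
  have hrec := isBigO_pi.1 (hh.isBigO_valueSum_sub_smul_sub_transfer hq hη) s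
  have hstates : (fun N => T.transfer ℝ (T.valueSum (N / q) - ((N / q : ℕ) : ℝ) • h) s
      - q * (T.valueSum (N / q) - ((N / q : ℕ) : ℝ) • h) s) =O[atTop] fun N => (N : ℝ) ^ η := by
    refine (IsBigO.of_norm_le fun N => ?_).trans
      ((isBigO_rpow_comp_div (NeZero.ne q) hη.le hspread).const_mul_left (q : ℝ))
    have hdigits : ∀ V : S → ℝ, T.transfer ℝ V s - q * V s = ∑ d, (V (T.next s d) - V s) :=
      fun V => by simp [transfer_apply]
    rw [hdigits]
    simpa using norm_sum_le_of_le Finset.univ fun (d : Fin q) _ =>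
      norm_sub_le_spread (T.valueSum (N / q) - ((N / q : ℕ) : ℝ) • h) (T.next s d) s
  have hmod := isBigO_mul_natCast_mod (h s) (NeZero.ne q) hη.le
  refine ((hrec.add hstates).add hmod).congr_left fun N => ?_
  have hN : (N : ℝ) = q * (N / q : ℕ) + (N % q : ℕ) := by
    exact_mod_cast (Nat.div_add_mod N q).symm
  simp only [Pi.sub_apply, Pi.smul_apply, smul_eq_mul, Function.const_apply]
  rw [hN]
  ring

end Asymptotics

end Transducer

section MainTerm

/-- The main terms `y (e log_q y + Ψ(log_q y))` of a summatory function, as a function of a real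
variable `y`; with periodic `Ψ`, its values at `y` and at `q y` are related. -/
noncomputable def mainTerm (q e : ℝ) (Ψ : ℝ → ℝ) (y : ℝ) : ℝ :=
  y * (e * Real.logb q y + Ψ (Real.logb q y))

variable {q e : ℝ} {Ψ : ℝ → ℝ}

theorem mainTerm_pow_mul (hq : 1 < q) (hΨ : Function.Periodic Ψ 1) {y : ℝ} (hy : 0 < y) (m : ℕ) :
    mainTerm q e Ψ (q ^ m * y) = q ^ m * (mainTerm q e Ψ y + e * m * y) := by
  have hlog : Real.logb q (q ^ m * y) = Real.logb q y + m * 1 := by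
    rw [Real.logb_mul (by positivity) hy.ne', Real.logb_pow, Real.logb_self_eq_one hq, add_comm]
  rw [mainTerm, mainTerm, hlog, hΨ.nat_mul m]
  ring

theorem differentiableAt_mainTerm (hq : 1 < q) {x : ℝ} (hΨ : DifferentiableAt ℝ Ψ x) :
    DifferentiableAt ℝ (mainTerm q e Ψ) (q ^ x) := by
  have hq0 : 0 < q := zero_lt_one.trans hq
  have hlog : DifferentiableAt ℝ (Real.logb q) (q ^ x) :=
    (Real.differentiableAt_log (by positivity)).div_const _
  have hcomp : DifferentiableAt ℝ (fun y => Ψ (Real.logb q y)) (q ^ x) :=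
    DifferentiableAt.comp (g := Ψ) _ (by rwa [Real.logb_rpow hq0 hq.ne']) hlog
  exact differentiableAt_id.mul ((hlog.const_mul e).add hcomp)

-- After scaling by `q ^ m`, the increment is a difference quotient with step `q ^ (-m)`.
theorem tendsto_mainTerm_add_one_sub (hq : 1 < q) (hΨ : Function.Periodic Ψ 1) {y f' : ℝ}
    (hy : 0 < y) (hf : HasDerivAt (mainTerm q e Ψ) f' y) {p : ℕ → ℝ}
    (hp : (fun m => p m - y * q ^ m) =O[atTop] fun _ => (1 : ℝ)) :
    Tendsto (fun m : ℕ => mainTerm q e Ψ (p m + 1) - mainTerm q e Ψ (p m) - e * m) atTop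
      (𝓝 f') := by
  obtain ⟨ε, hε⟩ : ∃ ε : ℕ → ℝ, ∀ m, ε m = (q ^ m)⁻¹ := ⟨_, fun _ => rfl⟩
  have hqε : ∀ m, q ^ m * ε m = 1 := fun m => by rw [hε, mul_inv_cancel₀ (by positivity)]
  have hεpos : ∀ m, 0 < ε m := fun m => by rw [hε]; positivity
  have hεlim : Tendsto ε atTop (𝓝 0) := by
    rw [funext hε]
    exact (tendsto_pow_atTop_atTop_of_one_lt hq).inv_tendsto_atTop
  have hleft : (fun m => p m * ε m - y) =O[atTop] ε :=
    (hp.mul (isBigO_refl ε _)).congr (fun m => by linear_combination -y * hqε m)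
      fun m => one_mul _
  have hright : (fun m => p m * ε m + ε m - y) =O[atTop] ε :=
    (hleft.add (isBigO_refl ε _)).congr_left fun m => by ring
  have hquot := (isLittleO_sub_sub_smul_of_hasDerivAt hf hεlim hleft hright).tendsto_div_nhds_zero
  have hpos : ∀ᶠ m in atTop, 0 < p m * ε m :=
    (tendsto_sub_nhds_zero_iff.1 (hleft.trans_tendsto hεlim)).eventually (lt_mem_nhds hy)
  refine tendsto_sub_nhds_zero_iff.1 (hquot.congr' (hpos.mono fun m hm => ?_))
  have hlow : mainTerm q e Ψ (p m) =
      q ^ m * (mainTerm q e Ψ (p m * ε m) + e * m * (p m * ε m)) := by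
    rw [← mainTerm_pow_mul hq hΨ hm, mul_left_comm, hqε, mul_one]
  have hhigh : mainTerm q e Ψ (p m + 1) =
      q ^ m * (mainTerm q e Ψ (p m * ε m + ε m) + e * m * (p m * ε m + ε m)) := by
    rw [← mainTerm_pow_mul hq hΨ (add_pos hm (hεpos m)), mul_add, mul_left_comm, hqε, mul_one]
  beta_reduce
  rw [hlow, hhigh, add_sub_cancel_left, smul_eq_mul, div_eq_iff (hεpos m).ne']
  linear_combination
    (mainTerm q e Ψ (p m * ε m) - mainTerm q e Ψ (p m * ε m + ε m) - e * m * ε m) * hqε m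

end MainTerm

namespace Transducer

section Fluctuation

variable {q : ℕ} [NeZero q] {S : Type*} [Fintype S] [DecidableEq S] {T : Transducer q S} {Ψ : ℝ → ℝ}

theorem HasResetSequence.exists_isFluctuation (hreset : T.HasResetSequence) (hq : 2 ≤ q) :
    ∃ Ψ : ℝ → ℝ, T.IsFluctuation Ψ := by
  obtain ⟨h, hh⟩ := hreset.exists_isPoissonSolution_mainConstant
  obtain ⟨η, hη, hη1, hrec⟩ := hreset.exists_isBigO_valueSum_sub_mul hq hh T.initial
  simp only [valueSum_apply] at hrec
  obtain ⟨Ψ, hcont, hper, hΨ⟩ := exists_periodic_of_sum_range_sub_mul_div hq hη.le hη1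
    (T.isBigO_valueFrom hq hη T.initial) hrec
  have hlog : (fun _ : ℕ => (1 : ℝ)) =O[atTop] fun N => Real.log N :=
    (Real.isLittleO_const_log_atTop.comp_tendsto tendsto_natCast_atTop_atTop).isBigO
  refine ⟨Ψ, hcont, hper, 1 - η, sub_pos.2 hη1, (hΨ.mul hlog).congr (fun N => ?_) fun N => ?_⟩
  · rw [mul_one, expectedValue_eq, valueSum_apply]
  · rw [neg_sub]

theorem IsFluctuation.tendsto_expectedValue_sub (hΨ : T.IsFluctuation Ψ) :
    Tendsto (fun N : ℕ => T.expectedValue N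
      - (T.mainConstant * Real.logb q N + Ψ (Real.logb q N))) atTop (𝓝 0) := by
  obtain ⟨ξ, hξ, hexp⟩ := hΨ.expansion
  refine hexp.trans_tendsto ?_
  refine ((isLittleO_log_rpow_atTop hξ).tendsto_div_nhds_zero.comp
    tendsto_natCast_atTop_atTop).congr fun N => ?_
  rw [Function.comp_apply, Real.rpow_neg N.cast_nonneg, div_eq_inv_mul]

theorem IsFluctuation.eq {Φ : ℝ → ℝ} (hΦ : T.IsFluctuation Φ) (hq : 2 ≤ q)
    (hΨ : T.IsFluctuation Ψ) : Φ = Ψ := by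
  have hlim := hΨ.tendsto_expectedValue_sub.sub hΦ.tendsto_expectedValue_sub
  refine sub_eq_zero.1 (eq_zero_of_periodic_of_tendsto_logb (q := q) (by exact_mod_cast hq)
    (hΦ.continuous.sub hΨ.continuous) (hΦ.periodic.sub hΨ.periodic) ?_)
  rw [sub_zero] at hlim
  exact hlim.congr fun N => by rw [Pi.sub_apply]; ring

theorem IsFluctuation.tendsto_valueSum (hΨ : T.IsFluctuation Ψ) (hq : 2 ≤ q) {p : ℕ} (hp : p ≠ 0) :
    Tendsto (fun j : ℕ => T.valueSum (q ^ j * p) T.initial / q ^ j - T.mainConstant * j * p) atTop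
      (𝓝 (mainTerm q T.mainConstant Ψ p)) := by
  have hp0 : (0 : ℝ) < p := by positivity
  have hblock : Tendsto (fun j : ℕ => q ^ j * p) atTop atTop :=
    (tendsto_pow_atTop_atTop_of_one_lt hq).atTop_mul_const' (Nat.pos_of_ne_zero hp)
  have hlim := ((hΨ.tendsto_expectedValue_sub.comp hblock).const_mul (p : ℝ)).add_const
    (mainTerm q T.mainConstant Ψ p)
  rw [mul_zero, zero_add] at hlim
  refine hlim.congr fun j => ?_
  have hscale := mainTerm_pow_mul (q := q) (e := T.mainConstant) (by exact_mod_cast hq)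
    hΨ.periodic hp0 j
  rw [mainTerm] at hscale
  rw [Function.comp_apply, expectedValue_eq]
  push_cast
  generalize Real.logb q (q ^ j * p) = x at hscale ⊢
  field_simp
  linear_combination -hscale

-- The dependence on `j` of the two limits describing the increments cancels.
theorem IsFluctuation.mainTerm_add_one_sub_sub (hΨ : T.IsFluctuation Ψ) (hq : 2 ≤ q) {p p' : ℕ}
    (hp : p ≠ 0) (hp' : p' ≠ 0) {c : ℝ}
    (hc : T.valueFrom p - T.valueFrom p' = Function.const S c) :
    mainTerm q T.mainConstant Ψ (p + 1) - mainTerm q T.mainConstant Ψ p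
      - (mainTerm q T.mainConstant Ψ (p' + 1) - mainTerm q T.mainConstant Ψ p') = c := by
  have hincr : ∀ {p : ℕ}, p ≠ 0 → Tendsto (fun j : ℕ => (T.valueSum (q ^ j * (p + 1)) T.initial
      - T.valueSum (q ^ j * p) T.initial) / q ^ j - T.mainConstant * j) atTop
      (𝓝 (mainTerm q T.mainConstant Ψ (p + 1) - mainTerm q T.mainConstant Ψ p)) := fun {p} hp => by
    have hlim := (hΨ.tendsto_valueSum hq p.succ_ne_zero).sub (hΨ.tendsto_valueSum hq hp)
    rw [Nat.cast_succ] at hlim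
    refine hlim.congr fun j => ?_
    rw [Nat.succ_eq_add_one]
    ring
  refine tendsto_nhds_unique ((hincr hp).sub (hincr hp')) (tendsto_const_nhds.congr fun j => ?_)
  have hblock := congrFun (T.valueSum_block_sub hq hp hp' j) T.initial
  rw [hc, transfer_pow_const] at hblock
  simp only [Pi.sub_apply, Function.const_apply] at hblock
  have hqj : (q : ℝ) ^ j ≠ 0 := by positivity
  field_simp
  linear_combination -hblock

-- Once the reset word has been read, the output depends on the remaining digits only.
theorem IsFluctuation.exists_mainTerm_add_one_sub_eq (hΨ : T.IsFluctuation Ψ) (hq : 2 ≤ q)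
    (hreset : T.HasResetSequence) :
    ∃ (v l : ℕ) (r : S) (γ : ℝ), ∀ n : ℕ, n ≠ 0 →
      mainTerm q T.mainConstant Ψ ((v + q ^ l * n : ℕ) + 1)
        - mainTerm q T.mainConstant Ψ (v + q ^ l * n : ℕ) = γ + T.valueFrom n r := by
  obtain ⟨w, r, hw⟩ := hreset
  obtain ⟨v, hv⟩ : ∃ v, Nat.ofDigits q (w.map Fin.val) = v := ⟨_, rfl⟩
  refine ⟨v, w.length, r, mainTerm q T.mainConstant Ψ ((v + q ^ w.length * 1 : ℕ) + 1)
    - mainTerm q T.mainConstant Ψ (v + q ^ w.length * 1 : ℕ) - T.valueFrom 1 r, fun n hn => ?_⟩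
  have hvalue : T.valueFrom (v + q ^ w.length * n) - T.valueFrom (v + q ^ w.length * 1) =
      Function.const S (T.valueFrom n r - T.valueFrom 1 r) := by
    funext s
    rw [← hv, Pi.sub_apply, T.valueFrom_ofDigits_add_sub hq w hn one_ne_zero, hw,
      Function.const_apply]
  linear_combination hΨ.mainTerm_add_one_sub_sub hq (by positivity) (by positivity) hvalue

theorem IsFluctuation.not_differentiableAt (hΨ : T.IsFluctuation Ψ) (hq : 2 ≤ q)
    (hreset : T.HasResetSequence) (hint : T.HasIntegerOutput)
    (he : ∀ k : ℤ, T.mainConstant ≠ k) (x : ℝ) : ¬ DifferentiableAt ℝ Ψ x := by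
  intro hdiff
  have hq1 : (1 : ℝ) < q := by exact_mod_cast hq
  obtain ⟨v, l, r, γ, hincr⟩ := hΨ.exists_mainTerm_add_one_sub_eq hq hreset
  obtain ⟨c, hc⟩ : ∃ c, c = (q : ℝ) ^ x / q ^ l := ⟨_, rfl⟩
  have hcpos : 0 < c := by rw [hc]; positivity
  have hfloor : (fun m : ℕ => ((v + q ^ l * ⌊c * q ^ m⌋₊ : ℕ) : ℝ) - (q : ℝ) ^ x * q ^ m)
      =O[atTop] fun _ => (1 : ℝ) := by
    refine (isBigO_add_mul_floor_sub (u := fun m : ℕ => c * q ^ m) (fun m => by positivity) v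
      (q ^ l)).congr_left fun m => ?_
    push_cast
    rw [← mul_assoc, mul_comm _ c, (eq_div_iff (by positivity)).1 hc]
  have hlim := tendsto_mainTerm_add_one_sub hq1 hΨ.periodic (by positivity)
    (differentiableAt_mainTerm (e := T.mainConstant) hq1 hdiff).hasDerivAt hfloor
  choose k hk using fun m => hint.exists_int_eq_outputSum r (inputWord q ⌊c * q ^ m⌋₊)
  have hpos : ∀ᶠ m in atTop, ⌊c * q ^ m⌋₊ ≠ 0 :=
    (tendsto_nat_floor_atTop.comp
      ((tendsto_pow_atTop_atTop_of_one_lt hq1).const_mul_atTop hcpos)).eventually_ne_atTop 0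
  obtain ⟨n, hn⟩ := exists_int_eq_of_tendsto_sub_mul (k := k) (e := T.mainConstant)
    ((hlim.sub_const γ).congr' (hpos.mono fun m hm => by
      rw [hincr _ hm, valueFrom, hk]
      ring))
  exact he n hn.symm

end Fluctuation

end Transducer

theorem theorem3 (q : ℕ) [NeZero q] (hq : 2 ≤ q) {S : Type*} [Fintype S] [DecidableEq S]
    (T : Transducer q S) (hreset : T.HasResetSequence) (hint : T.HasIntegerOutput)
    (he : ∀ k : ℤ, T.mainConstant ≠ k) :
    (∃! Ψ : ℝ → ℝ, T.IsFluctuation Ψ) ∧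
      ∀ Ψ : ℝ → ℝ, T.IsFluctuation Ψ → ∀ x : ℝ, ¬ DifferentiableAt ℝ Ψ x := by
  obtain ⟨Ψ, hΨ⟩ := hreset.exists_isFluctuation hq
  exact ⟨⟨Ψ, hΨ, fun Φ hΦ => hΦ.eq hq hΨ⟩,
    fun Φ hΦ x => hΦ.not_differentiableAt hq hreset hint he x⟩
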